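/- **Model.** A network is a finite simple graph $G=(V,E)$ with $n=|V|\ge 1$ nodes (not necessarily connected). Fix constants $b,c\ge 1$. Every node has a unique identifier in $\{0,\dots,n^{c}-1\}$, and all nodes know a common number $N$ with $n\le N\le n^{b}$. A distributed graph problem $\mathcal P$ is an isomorphism-invariant specification of admissible triples $(G,\vec x,\vec y)$ of a graph, node inputs and node outputs; it does not depend on the identifiers. The $r$-hop neighborhood of $v$ is the subgraph induced by the nodes at distance at most $r$ from $v$, together with their identifiers and current states. In a *LOCAL* algorithm with time complexity $t(n)$ every node computes its output from $N$ and from its $r$-hop neighborhood, where $r$ is determined by $N$ and $r\le t(n)$ on all $n$-node networks. In an *SLOCAL* algorithm with locality $t(n)$ the nodes are processed one by one in an arbitrary (adversarial) order; a node, when processed, reads its $r$-hop neighborhood (with $r$ determined by $N$ and $r\le t(n)$), including everything stored there by the nodes processed before, and it computes and stores its output and possibly additional information. In a *randomized* algorithm the initial state of each node also contains a private random bit string of unbounded length, and the strings of different nodes are independent. - $\mathrm{SLOCAL}(t(n))$: problems solved by a deterministic SLOCAL algorithm with locality $t(n)$, for every network, input and processing order. - A *randomized (Monte Carlo) SLOCAL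 algorithm* with locality $t(n)$ for $\mathcal P$: for every network, input and (fixed) processing order, the outputs solve $\mathcal P$ with probability larger than $1-1/n$. - $\mathrm{ZLOCAL}(t(n))$: problems with a Las Vegas LOCAL algorithm with time complexity $t(n)$: besides its output, each node $v$ outputs a flag $F_v\in\{0,1\}$; whenever all flags are $0$ the outputs solve $\mathcal P$, and $\sum_{v}\mathbb E[F_v]<1$. - polylog-SLOCAL and polylog-ZLOCAL are the unions of $\mathrm{SLOCAL}(t(n))$ and of $\mathrm{ZLOCAL}(t(n))$ over all $t(n)=O(\log^k n)$, $k\ge 0$ an integer. - $\mathcal P$ is *locally checkable* with radius $d$ (a constant) if there is a deterministic LOCAL algorithm of radius at most $d$ which, given all $(x_v,y_v)$ as inputs, accepts at all nodes if and only if $(G,\vec x,\vec y)$ is admissible. **Theorem.** For all constants $b,c\ge 1$ the following holds. 1. There is a constant $C$ (depending only on $b,c$) such that if a problem $\mathcal P$ is locally checkable with radius $d$ and has a randomized SLOCAL algorithm with locality $r(n)$, then $\mathcal P$ has a deterministic SLOCAL algorithm with locality $t(n)\le C\,(r(n)\log_2^2 n+d)$ for all $n\ge 1$. If $r(n)\ge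 1$ for all sufficiently large $n$, then moreover $t(n)=O(r(n)\log^2 n)$. 2. polylog-ZLOCAL $=$ polylog-SLOCAL. -/

import Mathlib

open MeasureTheory

noncomputable section

/-- A distributed graph problem with node inputs in `X` and node outputs in `Y`: a specification of
the admissible triples (graph, inputs, outputs). It is invariant under isomorphism and does not
mention identifiers. -/
structure DistProblem (X Y : Type) where
  spec : ∀ {V : Type} [Fintype V], SimpleGraph V → (V → X) → (V → Y) → Prop
  spec_iso : ∀ {V W : Type} [Fintype V] [Fintype W] (G : SimpleGraph V) (H : SimpleGraph W)
    (e : G ≃g H) (x : W → X) (y : W → Y), spec H x y → spec G (x ∘ e) (y ∘ e)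

/-- A network on the node set `V`, with `n` nodes: a simple graph, unique identifiers of
`O(log n)` bits (numbers below `n ^ c`), and a polynomial upper bound `n ≤ N ≤ n ^ b` on the number
of nodes. The number `N` is known to all nodes, `n` itself need not be. -/
structure Network (b c : ℕ) (V : Type) [Fintype V] where
  graph : SimpleGraph V
  id : V → ℕ
  id_injective : Function.Injective id
  id_lt : ∀ v, id v < Fintype.card V ^ c
  N : ℕ
  card_le : Fintype.card V ≤ N
  le_card_pow : N ≤ Fintype.card V ^ b

/-- What a node sees of its neighborhood. As identifiers are unique, nodes are named by their
identifiers: `center` is the identifier of the observer, `label i` is the state of the node with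
identifier `i` (`none` if there is no such node in the neighborhood), `adj` is the adjacency. -/
structure LocalView (L : Type) where
  center : ℕ
  label : ℕ → Option L
  adj : ℕ → ℕ → Prop

/-- The set of nodes at distance at most `r` from `v`. -/
def hopBall {V : Type} (G : SimpleGraph V) (v : V) (r : ℕ) : Set V :=
  {u | G.edist v u ≤ (r : ℕ∞)}

open Classical in
/-- The `r`-hop neighborhood of `v`: the subgraph induced by the nodes at distance at most `r`,
with the identifier and the current state `s u` of each of its nodes `u`. -/
def Network.view {b c : ℕ} {V : Type} [Fintype V] (I : Network b c V) {L : Type} (s : V → L)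
    (r : ℕ) (v : V) : LocalView L where
  center := I.id v
  label := fun i =>
    if h : ∃ u, u ∈ hopBall I.graph v r ∧ I.id u = i then some (s h.choose) else none
  adj := fun i j => ∃ u ∈ hopBall I.graph v r, ∃ w ∈ hopBall I.graph v r,
    I.id u = i ∧ I.id w = j ∧ I.graph.Adj u w

/-- An algorithm in the LOCAL model: given the known bound `N`, every node reads its
`radius N`-hop neighborhood, including all initial states, and computes its output from it. -/
structure LocalAlg (X Y : Type) where
  radius : ℕ → ℕ
  decide : ℕ → LocalView X → Y

/-- The output of a LOCAL algorithm at the node `v`, when the initial states are `x`. -/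
def LocalAlg.output {X Y : Type} (A : LocalAlg X Y) {b c : ℕ} {V : Type} [Fintype V]
    (I : Network b c V) (x : V → X) (v : V) : Y :=
  A.decide I.N (I.view x (A.radius I.N) v)

/-- An algorithm in the SLOCAL model. A processed node stores its output (in `Y`) and additional
information (in `M`). When a node is processed, it reads its `radius N`-hop neighborhood, with the
initial state of every node there and what that node has stored (`none` if it has not been
processed yet). -/
structure SLocalAlg (X Y M : Type) where
  radius : ℕ → ℕ
  step : ℕ → LocalView (X × Option (Y × M)) → Y × M

open Classical in
/-- The information stored in the network after the nodes in the list have been processed, in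
this order. -/
def SLocalAlg.run {X Y M : Type} (A : SLocalAlg X Y M) {b c : ℕ} {V : Type} [Fintype V]
    (I : Network b c V) (x : V → X) (order : List V) : V → Option (Y × M) :=
  order.foldl
    (fun mem v => Function.update mem v
      (some (A.step I.N (I.view (fun u => (x u, mem u)) (A.radius I.N) v))))
    (fun _ => none)

/-- The outputs after the nodes in the list have been processed. -/
def SLocalAlg.output {X Y M : Type} (A : SLocalAlg X Y M) {b c : ℕ} {V : Type} [Fintype V]
    (I : Network b c V) (x : V → X) (order : List V) (v : V) : Option Y :=
  (A.run I x order v).map Prod.fst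

/-- A processing order: every node occurs exactly once. -/
def IsProcessingOrder {V : Type} (order : List V) : Prop :=
  order.Nodup ∧ ∀ v, v ∈ order

/-- All nodes have an output, and together the outputs solve the problem. -/
def DistProblem.SolvedBy {X Y : Type} (P : DistProblem X Y) {V : Type} [Fintype V]
    (G : SimpleGraph V) (x : V → X) (o : V → Option Y) : Prop :=
  ∃ y : V → Y, (∀ v, o v = some (y v)) ∧ P.spec G x y

/-- The radius `ρ N` used when the known bound is `N` is at most `t n` on all `n`-node networks. -/
def RadiusBound (b : ℕ) (ρ t : ℕ → ℕ) : Prop :=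
  ∀ n N : ℕ, 1 ≤ n → n ≤ N → N ≤ n ^ b → ρ N ≤ t n

/-- A private random bit string, of unbounded length. -/
abbrev Tape : Type := ℕ → Bool

/-- Independent fair coin flips. -/
def coinMeasure : Measure Tape :=
  Measure.infinitePi fun _ : ℕ => (PMF.uniformOfFintype Bool).toMeasure

/-- The joint law of the random bit strings of all nodes, which are independent. -/
def tapesMeasure (V : Type) [Fintype V] : Measure (V → Tape) :=
  Measure.pi fun _ : V => coinMeasure

/-- Problems that have a deterministic SLOCAL algorithm with locality `t(n)`. -/
def SLOCAL (b c : ℕ) (t : ℕ → ℕ) {X Y : Type} : Set (DistProblem X Y) :=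
  {P | ∃ (M : Type) (A : SLocalAlg X Y M), RadiusBound b A.radius t ∧
    ∀ (V : Type) [Fintype V] [Nonempty V] (I : Network b c V) (x : V → X) (order : List V),
      IsProcessingOrder order → P.SolvedBy I.graph x (A.output I x order)}

/-- Problems that have a randomized (Monte Carlo) SLOCAL algorithm with locality `t(n)`: the
initial state of a node consists of its input and its random bit string, and for each processing
order the outputs solve the problem with probability larger than `1 - 1 / n`. The outputs have to
be random variables (with respect to the discrete σ-algebra on output vectors). -/
def RandSLOCAL (b c : ℕ) (t : ℕ → ℕ) {X Y : Type} : Set (DistProblem X Y) :=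
  {P | ∃ (M : Type) (A : SLocalAlg (X × Tape) Y M), RadiusBound b A.radius t ∧
    ∀ (V : Type) [Fintype V] [Nonempty V] (I : Network b c V) (x : V → X) (order : List V),
      IsProcessingOrder order →
        (∀ B : Set (V → Option Y),
          MeasurableSet {R : V → Tape | A.output I (fun v => (x v, R v)) order ∈ B}) ∧
        1 - 1 / (Fintype.card V : ℝ) < (tapesMeasure V).real
          {R : V → Tape | P.SolvedBy I.graph x (A.output I (fun v => (x v, R v)) order)}}

/-- Problems that have a Las Vegas algorithm in the LOCAL model with time complexity `t(n)`: each
node `v` outputs a value and a failure flag `F_v`; if no flag is raised, then the outputs solve the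
problem, and the sum of the expectations of the flags is less than `1`. -/
def ZLOCAL (b c : ℕ) (t : ℕ → ℕ) {X Y : Type} : Set (DistProblem X Y) :=
  {P | ∃ A : LocalAlg (X × Tape) (Y × Bool), RadiusBound b A.radius t ∧
    ∀ (V : Type) [Fintype V] [Nonempty V] (I : Network b c V) (x : V → X),
      (∀ R : V → Tape, (∀ v, (A.output I (fun u => (x u, R u)) v).2 = false) →
        P.spec I.graph x (fun v => (A.output I (fun u => (x u, R u)) v).1)) ∧
      (∀ v, MeasurableSet {R : V → Tape | (A.output I (fun u => (x u, R u)) v).2 = true}) ∧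
      ∑ v, (tapesMeasure V).real
        {R : V → Tape | (A.output I (fun u => (x u, R u)) v).2 = true} < 1}

/-- `t(n) = polylog n`. -/
def IsPolylog (t : ℕ → ℕ) : Prop :=
  ∃ k : ℕ, (fun n => (t n : ℝ)) =O[Filter.atTop] fun n : ℕ => Real.logb 2 n ^ k

/-- The class polylog-SLOCAL. -/
def PolySLOCAL (b c : ℕ) {X Y : Type} : Set (DistProblem X Y) :=
  {P | ∃ t, IsPolylog t ∧ P ∈ SLOCAL b c t}

/-- The class polylog-ZLOCAL. -/
def PolyZLOCAL (b c : ℕ) {X Y : Type} : Set (DistProblem X Y) :=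
  {P | ∃ t, IsPolylog t ∧ P ∈ ZLOCAL b c t}

/-- The validity of a solution can be checked by exploring the `d`-hop neighborhoods: there is a
deterministic LOCAL algorithm of radius at most `d` that reads inputs and outputs and accepts at
all nodes if and only if the outputs are a solution. It may use the identifiers. -/
def LocallyCheckable (b c d : ℕ) {X Y : Type} (P : DistProblem X Y) : Prop :=
  ∃ D : LocalAlg (X × Y) Bool, (∀ N, D.radius N ≤ d) ∧
    ∀ (V : Type) [Fintype V] [Nonempty V] (I : Network b c V) (x : V → X) (y : V → Y),
      (∀ v, D.output I (fun u => (x u, y u)) v = true) ↔ P.spec I.graph x y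

end

/-! Three facts carry the theorem.

Derandomization (`seqSolves_of_sum_lt_one`). Suppose failure events, one per node and each
determined by a ball of radius `ρ`, have total probability below `1`. The bits of `v` influence only
the events within `ρ` of `v`, so a sequential algorithm reading radius `2ρ` can fix them without
increasing the conditional expected number of failures. Once all bits are fixed, that expectation is
an actual count below `1`, hence `0`.

Clustering, as in Linial and Saks (`measureReal_forall_not_joins_le`, `isDecomposition_cluster`). In
each phase every node draws a geometric range; `u` follows the node of largest identifier that
reaches it and joins if reached with one unit to spare. By memorylessness a phase fails for `u` with
probability at most `1/2`. With `O(log N)` phases and ranges capped at `O(log N)`, the expected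
number of failure reports is below `1`.

Simulation (`run_colorOrder_congr`). Process the nodes color by color. Clusters of equal color do
not see each other, so each color adds only cluster diameter plus locality to the radius of
dependence. An SLOCAL algorithm thus becomes a local rule of radius `O(ρ log² N)`.

Las Vegas algorithms are derandomized directly. Conversely, random clustering plus simulation is a
Las Vegas algorithm whose flags report clustering failures. For a Monte Carlo algorithm, first
compute a clustering deterministically; this fixes a processing order, and each rejection of the
local checker has probability below `1/n`, so derandomization applies again. `SeqSolves.comp` merges
the stages into one sequential algorithm. -/

/-! ### Balls in the graph metric. -/

section HopBall

variable {V : Type} {G : SimpleGraph V}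

theorem mem_hopBall_self (v : V) (r : ℕ) : v ∈ hopBall G v r := by
  simp [hopBall]

theorem hopBall_mono {v : V} {r s : ℕ} (h : r ≤ s) : hopBall G v r ⊆ hopBall G v s :=
  fun _ hu => le_trans (show G.edist _ _ ≤ _ from hu) (by exact_mod_cast h)

theorem mem_hopBall_symm {u v : V} {r : ℕ} (h : u ∈ hopBall G v r) : v ∈ hopBall G u r := by
  have : G.edist v u ≤ r := h
  rwa [SimpleGraph.edist_comm] at this

theorem mem_hopBall_trans {u v w : V} {r s : ℕ} (h : u ∈ hopBall G v r) (h' : w ∈ hopBall G u s) :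
    w ∈ hopBall G v (r + s) := by
  have h₁ : G.edist v u ≤ r := h
  have h₂ : G.edist u w ≤ s := h'
  have := SimpleGraph.edist_triangle (G := G) (u := v) (v := u) (w := w)
  show G.edist v w ≤ ((r + s : ℕ) : ℕ∞)
  push_cast
  exact this.trans (add_le_add h₁ h₂)

theorem mem_hopBall_of_adj {u v : V} (h : G.Adj v u) : u ∈ hopBall G v 1 := by
  show G.edist v u ≤ _
  rw [SimpleGraph.edist_eq_one_iff_adj.2 h]
  rfl

theorem mem_hopBall_succ {u v : V} {r : ℕ} (h : u ∈ hopBall G v (r + 1)) :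
    u = v ∨ ∃ y ∈ hopBall G v r, G.Adj y u := by
  have h : G.edist v u ≤ ((r + 1 : ℕ) : ℕ∞) := h
  have hne : G.edist v u ≠ ⊤ := ne_top_of_le_ne_top (by simp) h
  obtain ⟨p, hp⟩ := SimpleGraph.exists_walk_of_edist_ne_top hne
  rw [← hp] at h
  have hl : p.length ≤ r + 1 := by exact_mod_cast h
  induction p using SimpleGraph.Walk.concatRec with
  | Hnil => exact Or.inl rfl
  | Hconcat q ha _ =>
    right
    refine ⟨_, ?_, ha⟩
    rw [SimpleGraph.Walk.length_concat] at hl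
    have : q.length ≤ r := by omega
    exact q.edist_le.trans (by exact_mod_cast this)

end HopBall

/-! ### Equality of views across networks. -/

namespace Network

variable {b c : ℕ} {V V' : Type} [Fintype V] [Fintype V']

theorem label_eq_some_iff (I : Network b c V) {L : Type} (s : V → L) (r : ℕ) (v : V) (i : ℕ)
    (a : L) : (I.view s r v).label i = some a ↔
      ∃ u ∈ hopBall I.graph v r, I.id u = i ∧ s u = a := by
  classical
  simp only [view]
  constructor
  · intro h
    split_ifs at h with hu
    exact ⟨_, hu.choose_spec.1, hu.choose_spec.2, by simpa using h⟩
  · rintro ⟨u, hu, rfl, rfl⟩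
    have h : ∃ w, w ∈ hopBall I.graph v r ∧ I.id w = I.id u := ⟨u, hu, rfl⟩
    rw [dif_pos h, I.id_injective h.choose_spec.2]

/-- The `r`-hop neighborhoods of `v` and `v'` agree, up to the states of the nodes. -/
structure Matches (I : Network b c V) (I' : Network b c V') (r : ℕ) (v : V) (v' : V') : Prop where
  id_eq : I.id v = I'.id v'
  fwd : ∀ u ∈ hopBall I.graph v r, ∃ u' ∈ hopBall I'.graph v' r, I.id u = I'.id u'
  bwd : ∀ u' ∈ hopBall I'.graph v' r, ∃ u ∈ hopBall I.graph v r, I.id u = I'.id u'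
  adj_iff : ∀ u ∈ hopBall I.graph v r, ∀ w ∈ hopBall I.graph v r,
    ∀ u' ∈ hopBall I'.graph v' r, ∀ w' ∈ hopBall I'.graph v' r,
    I.id u = I'.id u' → I.id w = I'.id w' → (I.graph.Adj u w ↔ I'.graph.Adj u' w')

/-- Views name nodes by identifiers only. This turns their equality into a correspondence of actual
nodes, the form in which all locality arguments are carried out. -/
theorem view_eq_iff {I : Network b c V} {I' : Network b c V'} {L : Type} {s : V → L} {s' : V' → L}
    {r : ℕ} {v : V} {v' : V'} : I.view s r v = I'.view s' r v' ↔
      I.Matches I' r v v' ∧ ∀ u ∈ hopBall I.graph v r, ∀ u' ∈ hopBall I'.graph v' r,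
        I.id u = I'.id u' → s u = s' u' := by
  constructor
  · intro h
    have hl : ∀ i a, (∃ u ∈ hopBall I.graph v r, I.id u = i ∧ s u = a) ↔
        ∃ u ∈ hopBall I'.graph v' r, I'.id u = i ∧ s' u = a := by
      intro i a
      rw [← label_eq_some_iff, ← label_eq_some_iff, h]
    have ha : ∀ i j, (I.view s r v).adj i j ↔ (I'.view s' r v').adj i j := by
      intro i j; rw [h]
    have hc : (I.view s r v).center = (I'.view s' r v').center := by rw [h]
    refine ⟨⟨hc, ?_, ?_, ?_⟩, ?_⟩
    · intro u hu
      obtain ⟨u', h1, h2, -⟩ := (hl (I.id u) (s u)).1 ⟨u, hu, rfl, rfl⟩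
      exact ⟨u', h1, h2.symm⟩
    · intro u hu
      obtain ⟨u', h1, h2, -⟩ := (hl (I'.id u) (s' u)).2 ⟨u, hu, rfl, rfl⟩
      exact ⟨u', h1, h2⟩
    · intro u hu w hw u' hu' w' hw' huu hww
      constructor
      · intro hadj
        obtain ⟨p, hp, q, hq, h1, h2, h3⟩ := (ha (I.id u) (I.id w)).1 ⟨u, hu, w, hw, rfl, rfl, hadj⟩
        rwa [I'.id_injective (h1.trans huu), I'.id_injective (h2.trans hww)] at h3
      · intro hadj
        obtain ⟨p, hp, q, hq, h1, h2, h3⟩ :=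
          (ha (I'.id u') (I'.id w')).2 ⟨u', hu', w', hw', rfl, rfl, hadj⟩
        rwa [I.id_injective (h1.trans huu.symm), I.id_injective (h2.trans hww.symm)] at h3
    · intro u hu u' hu' huu
      obtain ⟨p, hp, h1, h2⟩ := (hl (I.id u) (s u)).1 ⟨u, hu, rfl, rfl⟩
      rw [← h2, I'.id_injective (h1.trans huu)]
  · rintro ⟨h, hs⟩
    have h1 : (I.view s r v).label = (I'.view s' r v').label := by
      funext i
      apply Option.ext
      intro a
      rw [label_eq_some_iff, label_eq_some_iff]
      constructor
      · rintro ⟨u, hu, rfl, rfl⟩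
        obtain ⟨u', hu', hh⟩ := h.fwd u hu
        exact ⟨u', hu', hh.symm, (hs u hu u' hu' hh).symm⟩
      · rintro ⟨u', hu', rfl, rfl⟩
        obtain ⟨u, hu, hh⟩ := h.bwd u' hu'
        exact ⟨u, hu, hh, (hs u hu u' hu' hh)⟩
    have h2 : (I.view s r v).adj = (I'.view s' r v').adj := by
      funext i j
      apply propext
      constructor
      · rintro ⟨u, hu, w, hw, rfl, rfl, hadj⟩
        obtain ⟨u', hu', hh⟩ := h.fwd u hu
        obtain ⟨w', hw', hk⟩ := h.fwd w hw
        exact ⟨u', hu', w', hw', hh.symm, hk.symm, (h.adj_iff u hu w hw u' hu' w' hw' hh hk).1 hadj⟩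
      · rintro ⟨u', hu', w', hw', rfl, rfl, hadj⟩
        obtain ⟨u, hu, hh⟩ := h.bwd u' hu'
        obtain ⟨w, hw, hk⟩ := h.bwd w' hw'
        exact ⟨u, hu, w, hw, hh, hk, (h.adj_iff u hu w hw u' hu' w' hw' hh hk).2 hadj⟩
    have h3 : (I.view s r v).center = (I'.view s' r v').center := h.id_eq
    revert h1 h2 h3
    generalize I.view s r v = A
    generalize I'.view s' r v' = B
    cases A; cases B
    simp_all

namespace Matches

variable {I : Network b c V} {I' : Network b c V'} {r : ℕ} {v : V} {v' : V'}

theorem refl (I : Network b c V) (r : ℕ) (v : V) : I.Matches I r v v :=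
  (view_eq_iff (s := fun _ => ()) (s' := fun _ => ())).1 rfl |>.1

theorem symm (h : I.Matches I' r v v') : I'.Matches I r v' v where
  id_eq := h.id_eq.symm
  fwd u hu := (h.bwd u hu).imp fun _ => And.imp_right Eq.symm
  bwd u hu := (h.fwd u hu).imp fun _ => And.imp_right Eq.symm
  adj_iff u hu w hw u' hu' w' hw' h₁ h₂ :=
    (h.adj_iff u' hu' w' hw' u hu w hw h₁.symm h₂.symm).symm

/-- A short walk starting inside the smaller ball stays inside the matched ball, so it can be
transported edge by edge. Distances that fit in the view are therefore the same in both networks. -/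
theorem exists_mem (h : I.Matches I' r v v') {k j : ℕ} (hkj : k + j ≤ r) {u : V} {u' : V'}
    (hu : u ∈ hopBall I.graph v k) (hu' : u' ∈ hopBall I'.graph v' r) (huu : I.id u = I'.id u')
    {w : V} (hw : w ∈ hopBall I.graph u j) :
    ∃ w' ∈ hopBall I'.graph u' j, w' ∈ hopBall I'.graph v' r ∧ I.id w = I'.id w' := by
  induction j generalizing w with
  | zero =>
    have : u = w := by
      have hw : I.graph.edist u w ≤ ((0 : ℕ) : ℕ∞) := hw
      simpa using hw
    subst this
    exact ⟨u', mem_hopBall_self _ _, hu', huu⟩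
  | succ j ih =>
    rcases mem_hopBall_succ hw with rfl | ⟨y, hy, hadj⟩
    · exact ⟨u', mem_hopBall_self _ _, hu', huu⟩
    · obtain ⟨y', hy', hyr, hyy⟩ := ih (by omega) hy
      have hyv : y ∈ hopBall I.graph v r := hopBall_mono (by omega) (mem_hopBall_trans hu hy)
      have hwv : w ∈ hopBall I.graph v r := hopBall_mono (by omega) (mem_hopBall_trans hu hw)
      obtain ⟨w', hw', hww⟩ := h.fwd w hwv
      have := (h.adj_iff y hyv w hwv y' hyr w' hw' hyy hww).1 hadj
      exact ⟨w', mem_hopBall_trans hy' (mem_hopBall_of_adj this), hw', hww⟩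

theorem mem_hopBall (h : I.Matches I' r v v') {k : ℕ} (hk : k ≤ r) {u : V} {u' : V'}
    (hu : u ∈ hopBall I.graph v k) (huu : I.id u = I'.id u') : u' ∈ hopBall I'.graph v' k := by
  obtain ⟨w', hw', -, hw⟩ := h.exists_mem (k := 0) (j := k) (by omega) (mem_hopBall_self _ _)
    (mem_hopBall_self _ _) h.id_eq hu
  rwa [I'.id_injective (huu.symm.trans hw)]

theorem sub (h : I.Matches I' r v v') {k j : ℕ} (hkj : k + j ≤ r) {u : V} {u' : V'}
    (hu : u ∈ hopBall I.graph v k) (huu : I.id u = I'.id u') : I.Matches I' j u u' := by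
  have hu' := h.mem_hopBall (by omega) hu huu
  refine ⟨huu, fun w hw => ?_, fun w' hw' => ?_, ?_⟩
  · obtain ⟨w', h1, -, h2⟩ := h.exists_mem hkj hu (hopBall_mono (by omega) hu') huu hw
    exact ⟨w', h1, h2⟩
  · obtain ⟨w, h1, -, h2⟩ := h.symm.exists_mem hkj hu' (hopBall_mono (by omega) hu) huu.symm hw'
    exact ⟨w, h1, h2.symm⟩
  · intro w hw x hx w' hw' x' hx'
    exact h.adj_iff w (hopBall_mono hkj (mem_hopBall_trans hu hw))
      x (hopBall_mono hkj (mem_hopBall_trans hu hx))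
      w' (hopBall_mono hkj (mem_hopBall_trans hu' hw'))
      x' (hopBall_mono hkj (mem_hopBall_trans hu' hx'))

theorem mono (h : I.Matches I' r v v') {j : ℕ} (hj : j ≤ r) : I.Matches I' j v v' :=
  h.sub (k := 0) (by omega) (mem_hopBall_self _ _) h.id_eq

theorem exists_corr (h : I.Matches I' r v v') {k : ℕ} (hk : k ≤ r) {u : V}
    (hu : u ∈ hopBall I.graph v k) : ∃ u' ∈ hopBall I'.graph v' k, I.id u = I'.id u' :=
  (h.mono hk).fwd u hu

end Matches

/-- Equal views restrict to equal views of smaller radius at nearby nodes. -/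
theorem view_sub {I : Network b c V} {I' : Network b c V'} {L : Type} {s : V → L} {s' : V' → L}
    {r k j : ℕ} {v : V} {v' : V'} (h : I.view s r v = I'.view s' r v') (hkj : k + j ≤ r)
    {u : V} {u' : V'} (hu : u ∈ hopBall I.graph v k) (huu : I.id u = I'.id u') :
    I.view s j u = I'.view s' j u' := by
  rw [view_eq_iff] at h ⊢
  have hu' := h.1.mem_hopBall (by omega) hu huu
  exact ⟨h.1.sub hkj hu huu, fun w hw w' hw' => h.2 w (hopBall_mono hkj (mem_hopBall_trans hu hw))
    w' (hopBall_mono hkj (mem_hopBall_trans hu' hw'))⟩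

/-- Views with the same nodes and states determined by the states of equal views are equal. -/
theorem view_comp {I : Network b c V} {I' : Network b c V'} {L L' : Type} {s : V → L} {s' : V' → L}
    {r : ℕ} {v : V} {v' : V'} (h : I.view s r v = I'.view s' r v') (t : V → L') (t' : V' → L')
    (ht : ∀ u ∈ hopBall I.graph v r, ∀ u' ∈ hopBall I'.graph v' r, I.id u = I'.id u' →
      s u = s' u' → t u = t' u') : I.view t r v = I'.view t' r v' := by
  rw [view_eq_iff] at h ⊢
  exact ⟨h.1, fun u hu u' hu' huu => ht u hu u' hu' huu (h.2 u hu u' hu' huu)⟩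

theorem view_congr {I : Network b c V} {L : Type} {s s' : V → L} {r : ℕ} {v : V}
    (h : ∀ u ∈ hopBall I.graph v r, s u = s' u) : I.view s r v = I.view s' r v := by
  rw [view_eq_iff]
  refine ⟨Matches.refl I r v, fun u hu u' _ huu => ?_⟩
  rw [← I.id_injective huu]
  exact h u hu

theorem id_lt_N_pow (I : Network b c V) (v : V) : I.id v < I.N ^ c :=
  (I.id_lt v).trans_le (Nat.pow_le_pow_left I.card_le c)

end Network

/-! ### Local quantities. -/

/-- A quantity attached to a node of a network whose nodes have states. -/
abbrev NodeFun (b c : ℕ) (L Z : Type) : Type 1 :=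
  ∀ (V : Type) [Fintype V], Network b c V → (V → L) → V → Z

/-- A property of networks whose nodes have states. -/
abbrev StateProp (b c : ℕ) (L : Type) : Type 1 :=
  ∀ (V : Type) [Fintype V], Network b c V → (V → L) → Prop

/-- On the networks with the property `Q`, the quantity `Φ` is determined by `N` and by the
neighborhoods of radius `ρ N`. -/
def IsLocal {b c : ℕ} {L Z : Type} (Q : StateProp b c L) (ρ : ℕ → ℕ) (Φ : NodeFun b c L Z) : Prop :=
  ∀ (V V' : Type) [Fintype V] [Fintype V'] (I : Network b c V) (I' : Network b c V')
    (s : V → L) (s' : V' → L) (v : V) (v' : V'), Q V I s → Q V' I' s' → I.N = I'.N →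
    I.view s (ρ I.N) v = I'.view s' (ρ I.N) v' → Φ V I s v = Φ V' I' s' v'

/-- Given a view, pick any network with property `Q` that realizes it and evaluate `Φ` there;
locality makes the choice irrelevant. Algorithms can thus be specified by quantities on networks
instead of functions of views. -/
theorem IsLocal.exists_step {b c : ℕ} {L Z : Type} [Nonempty Z] {Q : StateProp b c L} {ρ : ℕ → ℕ}
    {Φ : NodeFun b c L Z} (h : IsLocal Q ρ Φ) : ∃ step : ℕ → LocalView L → Z,
      ∀ (V : Type) [Fintype V] (I : Network b c V) (s : V → L) (v : V), Q V I s →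
        step I.N (I.view s (ρ I.N) v) = Φ V I s v := by
  classical
  let E : ℕ → LocalView L → Z → Prop := fun N w z =>
    ∃ (V : Type) (_ : Fintype V) (I : Network b c V) (s : V → L) (v : V),
      Q V I s ∧ I.N = N ∧ I.view s (ρ N) v = w ∧ Φ V I s v = z
  refine ⟨fun N w => Classical.epsilon (E N w), fun V _ I s v hQ => ?_⟩
  have hE : ∃ z, E I.N (I.view s (ρ I.N) v) z := ⟨_, V, _, I, s, v, hQ, rfl, rfl, rfl⟩
  obtain ⟨V', _, I', s', v', hQ', hN, hv, hz⟩ := Classical.epsilon_spec hE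
  refine hz.symm.trans ?_
  refine h V' V I' I s' s v' v hQ' hQ hN ?_
  rw [hN, hv]

/-! ### Runs of sequential algorithms. -/

namespace SLocalAlg

variable {b c : ℕ} {V : Type} [Fintype V] {X Y M : Type}

open Classical in
theorem run_concat (A : SLocalAlg X Y M) (I : Network b c V) (x : V → X) (p : List V) (v : V) :
    A.run I x (p ++ [v]) = Function.update (A.run I x p) v
      (some (A.step I.N (I.view (fun u => (x u, A.run I x p u)) (A.radius I.N) v))) := by
  simp [run, List.foldl_append]

theorem run_concat_self (A : SLocalAlg X Y M) (I : Network b c V) (x : V → X) (p : List V) (v : V) :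
    A.run I x (p ++ [v]) v =
      some (A.step I.N (I.view (fun u => (x u, A.run I x p u)) (A.radius I.N) v)) := by
  classical rw [run_concat, Function.update_self]

theorem run_concat_of_ne (A : SLocalAlg X Y M) (I : Network b c V) (x : V → X) (p : List V)
    {u v : V} (h : u ≠ v) : A.run I x (p ++ [v]) u = A.run I x p u := by
  classical rw [run_concat, Function.update_of_ne h]

theorem run_eq_none_iff (A : SLocalAlg X Y M) (I : Network b c V) (x : V → X) (p : List V) (v : V) :
    A.run I x p v = none ↔ v ∉ p := by
  induction p using List.reverseRecOn with
  | nil => simp [run]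
  | append_singleton p w ih =>
    by_cases h : v = w
    · subst h; simp [run_concat_self]
    · rw [run_concat_of_ne _ _ _ _ h, ih]; simp [h]

theorem run_append_of_notMem (A : SLocalAlg X Y M) (I : Network b c V) (x : V → X) (p q : List V)
    {u : V} (h : u ∉ q) : A.run I x (p ++ q) u = A.run I x p u := by
  induction q using List.reverseRecOn with
  | nil => simp
  | append_singleton q w ih =>
    rw [List.mem_append, not_or] at h
    rw [← List.append_assoc, run_concat_of_ne _ _ _ _ (by simpa using h.2), ih h.1]

end SLocalAlg

/-- Some deterministic SLOCAL algorithm of locality `ρ N` achieves, on every network and for every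
processing order, outputs that are related to the inputs by `T`. -/
def SeqSolves {b c : ℕ} {S Z : Type} (ρ : ℕ → ℕ)
    (T : ∀ (V : Type) [Fintype V], Network b c V → (V → S) → (V → Z) → Prop) : Prop :=
  ∃ (M : Type) (A : SLocalAlg S Z M), A.radius = ρ ∧
    ∀ (V : Type) [Fintype V] [Nonempty V] (I : Network b c V) (s : V → S) (order : List V),
      IsProcessingOrder order → ∃ z : V → Z, (∀ v, A.output I s order v = some (z v)) ∧ T V I s z

/-! ### Composition of sequential algorithms. -/

section Composition

variable {b c : ℕ} {S W L : Type}

open Classical in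
/-- Some element with the property `E`, if there is one. -/
noncomputable def someSuch (E : W → Prop) : Option W :=
  if h : ∃ a, E a then some h.choose else none

theorem someSuch_eq_some {E : W → Prop} {a : W} (h : someSuch E = some a) : E a := by
  unfold someSuch at h
  split_ifs at h with h'
  obtain rfl : h'.choose = a := by simpa using h
  exact h'.choose_spec

theorem someSuch_ne_none {E : W → Prop} {a : W} (h : E a) : someSuch E ≠ none := by
  unfold someSuch
  rw [dif_pos ⟨a, h⟩]
  simp

/-- The union of the partial maps `know u`, over the nodes `u` in a ball. -/
noncomputable def mergeBall {V : Type} [Fintype V] (I : Network b c V) (know : V → ℕ → Option W)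
    (R : ℕ) (v : V) (i : ℕ) : Option W :=
  someSuch fun a => ∃ u ∈ hopBall I.graph v R, know u i = some a

/-- The chosen value depends only on the set of candidates, and this set can be read off the view.
-/
theorem mergeBall_congr {V V' : Type} [Fintype V] [Fintype V'] {I : Network b c V}
    {I' : Network b c V'} {know : V → ℕ → Option W} {know' : V' → ℕ → Option W} {R : ℕ} {v : V}
    {v' : V'} (h : I.view know R v = I'.view know' R v') :
    mergeBall I know R v = mergeBall I' know' R v' := by
  have key : ∀ i a, (∃ u ∈ hopBall I.graph v R, know u i = some a) ↔
      ∃ u ∈ hopBall I'.graph v' R, know' u i = some a := by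
    rw [Network.view_eq_iff] at h
    intro i a
    constructor
    · rintro ⟨u, hu, hk⟩
      obtain ⟨u', hu', huu⟩ := h.1.fwd u hu
      exact ⟨u', hu', by rw [← h.2 u hu u' hu' huu, hk]⟩
    · rintro ⟨u', hu', hk⟩
      obtain ⟨u, hu, huu⟩ := h.1.bwd u' hu'
      exact ⟨u, hu, by rw [h.2 u hu u' hu' huu, hk]⟩
  funext i
  exact congrArg someSuch (funext fun a => propext (key i a))

variable {Z M : Type}

open Classical in
/-- Executes `A` at the node with identifier `i`, if it is within distance `R` of `v` and has not
been executed according to `m`. -/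
noncomputable def execAt (A : SLocalAlg S Z M) {V : Type} [Fintype V] (I : Network b c V) (s : V → S) (R : ℕ)
    (v : V) (m : ℕ → Option (Z × M)) (i : ℕ) : ℕ → Option (Z × M) :=
  if h : ∃ u ∈ hopBall I.graph v R, I.id u = i ∧ m i = none then
    Function.update m i
      (some (A.step I.N (I.view (fun u => (s u, m (I.id u))) (A.radius I.N) h.choose)))
  else m

/-- The executed node is within `k` and reads `A.radius I.N` further; the identifier `i` determines
it in both networks. -/
theorem execAt_congr (A : SLocalAlg S Z M) {V V' : Type} [Fintype V] [Fintype V']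
    {I : Network b c V} {I' : Network b c V'} {s : V → S} {s' : V' → S} {R k : ℕ} {v : V} {v' : V'}
    (hN : I.N = I'.N) (h : I.view s R v = I'.view s' R v') (hR : k + A.radius I.N ≤ R)
    (m : ℕ → Option (Z × M)) (i : ℕ) : execAt A I s k v m i = execAt A I' s' k v' m i := by
  have hm := (Network.view_eq_iff.1 h).1
  have key : (∃ u ∈ hopBall I.graph v k, I.id u = i ∧ m i = none) ↔
      ∃ u ∈ hopBall I'.graph v' k, I'.id u = i ∧ m i = none := by
    constructor
    · rintro ⟨u, hu, hi, h0⟩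
      obtain ⟨u', hu', huu⟩ := hm.exists_corr (by omega) hu
      exact ⟨u', hu', huu ▸ hi, h0⟩
    · rintro ⟨u, hu, hi, h0⟩
      obtain ⟨u', hu', huu⟩ := hm.symm.exists_corr (by omega) hu
      exact ⟨u', hu', huu ▸ hi, h0⟩
  unfold execAt
  by_cases h1 : ∃ u ∈ hopBall I.graph v k, I.id u = i ∧ m i = none
  · have h2 := key.1 h1
    rw [dif_pos h1, dif_pos h2]
    have e1 := h1.choose_spec
    have e2 := h2.choose_spec
    have huu : I.id h1.choose = I'.id h2.choose := e1.2.1.trans e2.2.1.symm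
    rw [← hN, Network.view_comp (Network.view_sub h hR e1.1 huu)
      (fun u => (s u, m (I.id u))) (fun u => (s' u, m (I'.id u)))]
    intro u _ u' _ hu hs
    rw [hu, hs]
  · rw [dif_neg h1, dif_neg (fun h2 => h1 (key.2 h2))]

theorem foldl_execAt_congr (A : SLocalAlg S Z M) {V V' : Type} [Fintype V] [Fintype V']
    {I : Network b c V} {I' : Network b c V'} {s : V → S} {s' : V' → S} {R k : ℕ} {v : V} {v' : V'}
    (hN : I.N = I'.N) (h : I.view s R v = I'.view s' R v') (hR : k + A.radius I.N ≤ R) (l : List ℕ)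
    (m : ℕ → Option (Z × M)) :
    l.foldl (execAt A I s k v) m = l.foldl (execAt A I' s' k v') m := by
  induction l generalizing m with
  | nil => rfl
  | cons i l ih => rw [List.foldl_cons, List.foldl_cons, ih, execAt_congr A hN h hR]

/-- The partial map `m` records states of the run of `A` over `p`, and all those near `v`. -/
structure Records (A : SLocalAlg S Z M) {V : Type} [Fintype V] (I : Network b c V) (s : V → S)
    (p : List V) (k : ℕ) (v : V) (m : ℕ → Option (Z × M)) : Prop where
  sound : ∀ u a, m (I.id u) = some a → A.run I s p u = some a
  complete : ∀ u ∈ hopBall I.graph v (k + A.radius I.N), m (I.id u) = A.run I s p u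

/-- The list `p'` extends `p` by nodes near `v`. -/
structure ExtendsNear {V : Type} [Fintype V] (I : Network b c V) (k : ℕ) (v : V)
    (p p' : List V) : Prop where
  nodup : p'.Nodup
  exists_append : ∃ q, p' = p ++ q ∧ ∀ u ∈ q, u ∈ hopBall I.graph v k

theorem ExtendsNear.run_eq {V : Type} [Fintype V] {I : Network b c V} {k : ℕ} {v : V}
    {p p' : List V} (h : ExtendsNear I k v p p') (A : SLocalAlg S Z M) (s : V → S) {u : V}
    (hu : u ∈ p) : A.run I s p' u = A.run I s p u := by
  obtain ⟨q, rfl, -⟩ := h.exists_append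
  refine A.run_append_of_notMem I s p q fun hq => ?_
  exact (List.nodup_append.1 h.nodup).2.2 u hu u hq rfl

theorem ExtendsNear.trans {V : Type} [Fintype V] {I : Network b c V} {k : ℕ} {v : V}
    {p p' p'' : List V} (h : ExtendsNear I k v p p') (h' : ExtendsNear I k v p' p'') :
    ExtendsNear I k v p p'' := by
  obtain ⟨q, rfl, hq⟩ := h.exists_append
  obtain ⟨q', rfl, hq'⟩ := h'.exists_append
  refine ⟨h'.nodup, q ++ q', by simp, fun u hu => ?_⟩
  rcases List.mem_append.1 hu with hu | hu
  exacts [hq u hu, hq' u hu]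

theorem ExtendsNear.mem {V : Type} [Fintype V] {I : Network b c V} {k : ℕ} {v : V}
    {p p' : List V} (h : ExtendsNear I k v p p') {u : V} (hu : u ∈ p) : u ∈ p' := by
  obtain ⟨q, rfl, -⟩ := h.exists_append
  exact List.mem_append_left _ hu

/-- If a node is executed, its view under `m` equals its view in the true run, since `m` is complete
on the ball of radius `k + A.radius I.N`. The local execution is therefore a genuine step that
appends one node to the order. -/
theorem execAt_records (A : SLocalAlg S Z M) {V : Type} [Fintype V] {I : Network b c V} {s : V → S}
    {p : List V} (hp : p.Nodup) {k : ℕ} {v : V} {m : ℕ → Option (Z × M)}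
    (h : Records A I s p k v m) (i : ℕ) :
    ∃ p', ExtendsNear I k v p p' ∧ Records A I s p' k v (execAt A I s k v m i) ∧
      ∀ u ∈ hopBall I.graph v k, I.id u = i → u ∈ p' := by
  by_cases h1 : ∃ u ∈ hopBall I.graph v k, I.id u = i ∧ m i = none
  · unfold execAt
    rw [dif_pos h1]
    obtain ⟨hu, hui, hi⟩ := h1.choose_spec
    generalize h1.choose = u at hu hui
    subst hui
    -- By completeness near `v`, a missing record means that the node is really unprocessed.
    have hup : u ∉ p := by
      rw [← A.run_eq_none_iff I s, ← h.complete u (hopBall_mono (by omega) hu), hi]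
    have hview : I.view (fun w => (s w, m (I.id w))) (A.radius I.N) u =
        I.view (fun w => (s w, A.run I s p w)) (A.radius I.N) u := by
      refine Network.view_congr fun w hw => ?_
      rw [h.complete w (mem_hopBall_trans hu hw)]
    have heq : ∀ w, w = u ∨ w ≠ u ∧ I.id w ≠ I.id u := fun w =>
      (eq_or_ne w u).imp_right fun hw => ⟨hw, fun hh => hw (I.id_injective hh)⟩
    refine ⟨p ++ [u], ⟨?_, [u], rfl, by simpa using hu⟩, ⟨fun w a hw => ?_, fun w hw => ?_⟩, ?_⟩
    · simp [List.nodup_append, hp]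
      rintro a ha rfl
      exact hup ha
    · rcases heq w with rfl | ⟨hne, hid⟩
      · rw [Function.update_self, hview] at hw
        rw [A.run_concat_self, hw]
      · rw [Function.update_of_ne hid] at hw
        rw [A.run_concat_of_ne _ _ _ hne]
        exact h.sound w a hw
    · rcases heq w with rfl | ⟨hne, hid⟩
      · rw [Function.update_self, hview, A.run_concat_self]
      · rw [Function.update_of_ne hid, A.run_concat_of_ne _ _ _ hne]
        exact h.complete w hw
    · intro w _ hw
      simp [I.id_injective hw]
  · unfold execAt
    rw [dif_neg h1]
    refine ⟨p, ⟨hp, [], by simp, by simp⟩, h, fun u hu hui => ?_⟩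
    by_contra hup
    rw [← A.run_eq_none_iff I s, ← h.complete u (hopBall_mono (by omega) hu), hui] at hup
    exact h1 ⟨u, hu, hui, hup⟩

theorem foldl_execAt_records (A : SLocalAlg S Z M) {V : Type} [Fintype V] {I : Network b c V}
    {s : V → S} {p : List V} (hp : p.Nodup) {k : ℕ} {v : V} {m : ℕ → Option (Z × M)}
    (h : Records A I s p k v m) (l : List ℕ) :
    ∃ p', ExtendsNear I k v p p' ∧ Records A I s p' k v (l.foldl (execAt A I s k v) m) ∧
      ∀ u ∈ hopBall I.graph v k, I.id u ∈ l → u ∈ p' := by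
  induction l generalizing m p with
  | nil => exact ⟨p, ⟨hp, [], by simp, by simp⟩, h, by simp⟩
  | cons i l ih =>
    obtain ⟨p₁, h₁, hr₁, hm₁⟩ := execAt_records A hp h i
    obtain ⟨p₂, h₂, hr₂, hm₂⟩ := ih h₁.nodup hr₁
    refine ⟨p₂, h₁.trans h₂, hr₂, fun u hu hui => ?_⟩
    rcases List.mem_cons.1 hui with hui | hui
    exacts [h₂.mem (hm₁ u hu hui), hm₂ u hu hui]

end Composition

theorem SLocalAlg.nonempty_output {S Z M : Type} (A : SLocalAlg S Z M) : Nonempty (Z × M) :=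
  ⟨A.step 0 ⟨0, fun _ => none, fun _ _ => False⟩⟩

section Compose

variable {b c : ℕ} {S Z₁ Z₂ M₁ M₂ : Type}

/-- The states that a node of the composed algorithm knows after executing the first algorithm in
its neighborhood. -/
noncomputable def composeKnown (A₁ : SLocalAlg S Z₁ M₁) (ρ : ℕ → ℕ) {V : Type} [Fintype V]
    (I : Network b c V) (lab : V → S × Option (Z₂ × M₂ × (ℕ → Option (Z₁ × M₁)))) (v : V) :
    ℕ → Option (Z₁ × M₁) :=
  (List.range (I.N ^ c)).foldl (execAt A₁ I (fun u => (lab u).1) (ρ I.N) v)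
    (mergeBall I (fun u i => (lab u).2.bind fun g => g.2.2 i) (A₁.radius I.N + 2 * ρ I.N) v)

/-- The state that a node of the composed algorithm stores. -/
noncomputable def composeState (A₁ : SLocalAlg S Z₁ M₁) (A₂ : SLocalAlg (S × Z₁) Z₂ M₂)
    (z₀ : Z₁) : NodeFun b c (S × Option (Z₂ × M₂ × (ℕ → Option (Z₁ × M₁))))
      (Z₂ × M₂ × (ℕ → Option (Z₁ × M₁))) :=
  fun _ _ I lab v =>
    let m := composeKnown A₁ A₂.radius I lab v
    let out := A₂.step I.N (I.view (fun u => (((lab u).1, (m (I.id u)).elim z₀ Prod.fst),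
      (lab u).2.map fun g => (g.1, g.2.1))) (A₂.radius I.N) v)
    (out.1, out.2, m)

theorem isLocal_composeState (A₁ : SLocalAlg S Z₁ M₁) (A₂ : SLocalAlg (S × Z₁) Z₂ M₂) (z₀ : Z₁) :
    IsLocal (fun _ _ _ _ => True) (fun N => A₁.radius N + 2 * A₂.radius N)
      (composeState (b := b) (c := c) A₁ A₂ z₀) := by
  intro V V' _ _ I I' lab lab' v v' _ _ hN h
  beta_reduce at h
  have hm : composeKnown A₁ A₂.radius I lab v = composeKnown A₁ A₂.radius I' lab' v' := by
    unfold composeKnown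
    rw [← hN, mergeBall_congr (Network.view_comp h _
      (fun u i => (lab' u).2.bind fun g => g.2.2 i) (fun u _ u' _ _ hs => by rw [hs]))]
    exact foldl_execAt_congr A₁ hN (Network.view_comp h _ _ (fun u _ u' _ _ hs => by rw [hs]))
      (by omega) _ _
  have hv := Network.view_sub (k := 0) (j := A₂.radius I.N) h (by omega) (mem_hopBall_self _ _)
    (Network.view_eq_iff.1 h).1.id_eq
  have hv' := Network.view_comp hv
    (fun u => (((lab u).1, (composeKnown A₁ A₂.radius I lab v (I.id u)).elim z₀ Prod.fst),
      (lab u).2.map fun g => (g.1, g.2.1)))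
    (fun u => (((lab' u).1, (composeKnown A₁ A₂.radius I lab v (I'.id u)).elim z₀ Prod.fst),
      (lab' u).2.map fun g => (g.1, g.2.1)))
    (fun u _ u' _ huu hs => by rw [hs, huu])
  simp only [composeState]
  rw [← hm, hv', hN]

/-- The relation between a partial run of the composed algorithm `A` and partial runs of its
parts. -/
structure ComposeInv (A₁ : SLocalAlg S Z₁ M₁) (A₂ : SLocalAlg (S × Z₁) Z₂ M₂) {V : Type}
    [Fintype V] (I : Network b c V) (s : V → S) (p p₁ : List V)
    (mem : V → Option (Z₂ × M₂ × (ℕ → Option (Z₁ × M₁)))) : Prop where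
  nodup : p₁.Nodup
  sound : ∀ w g, mem w = some g → ∀ u a, g.2.2 (I.id u) = some a → A₁.run I s p₁ u = some a
  complete : ∀ u a, A₁.run I s p₁ u = some a →
    ∃ w ∈ hopBall I.graph u (A₂.radius I.N), ∃ g, mem w = some g ∧ g.2.2 (I.id u) = some a
  near : ∀ w ∈ p, ∀ u ∈ hopBall I.graph w (A₂.radius I.N), u ∈ p₁
  run_eq : ∀ z₁ : V → Z₁, (∀ u ∈ p₁, (A₁.run I s p₁ u).map Prod.fst = some (z₁ u)) →
    A₂.run I (fun v => (s v, z₁ v)) p = fun u => (mem u).map fun g => (g.1, g.2.1)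

/-- Executing the first algorithm within `A₂.radius` of `v` requires states up to `A₁.radius +
A₂.radius` away. Each such state is stored at most `A₂.radius` further out, hence the radius
`A₁.radius + 2 * A₂.radius`. Soundness makes all stored copies agree. -/
theorem ComposeInv.records {A₁ : SLocalAlg S Z₁ M₁} {A₂ : SLocalAlg (S × Z₁) Z₂ M₂} {V : Type}
    [Fintype V] {I : Network b c V} {s : V → S} {p p₁ : List V}
    {mem : V → Option (Z₂ × M₂ × (ℕ → Option (Z₁ × M₁)))} (h : ComposeInv A₁ A₂ I s p p₁ mem)
    (v : V) : Records A₁ I s p₁ (A₂.radius I.N) v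
      (mergeBall I (fun u i => (mem u).bind fun g => g.2.2 i)
        (A₁.radius I.N + 2 * A₂.radius I.N) v) := by
  have hs : ∀ u a, mergeBall I (fun u i => (mem u).bind fun g => g.2.2 i)
      (A₁.radius I.N + 2 * A₂.radius I.N) v (I.id u) = some a → A₁.run I s p₁ u = some a := by
    intro u a hu
    obtain ⟨w, -, hw⟩ := someSuch_eq_some hu
    obtain ⟨g, hg, hga⟩ := Option.bind_eq_some_iff.1 hw
    exact h.sound w g hg u a hga
  refine ⟨hs, fun u hu => ?_⟩
  cases hr : A₁.run I s p₁ u with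
  | none =>
    cases hm : mergeBall I (fun u i => (mem u).bind fun g => g.2.2 i)
      (A₁.radius I.N + 2 * A₂.radius I.N) v (I.id u) with
    | none => rfl
    | some a => rw [hs u a hm] at hr; cases hr
  | some a =>
    obtain ⟨w, hw, g, hg, hga⟩ := h.complete u a hr
    have hne : mergeBall I (fun u i => (mem u).bind fun g => g.2.2 i)
      (A₁.radius I.N + 2 * A₂.radius I.N) v (I.id u) ≠ none :=
      someSuch_ne_none (a := a) ⟨w, hopBall_mono (by omega) (mem_hopBall_trans hu hw),
        by simp [hg, hga]⟩
    obtain ⟨a', ha'⟩ := Option.ne_none_iff_exists'.1 hne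
    rw [ha', ← hr, hs u a' ha']

/-- Processing `v` extends the virtual order of the first algorithm by the missing nodes near `v`,
and only then performs the step of the second algorithm. Earlier records stay valid because nodes
already in `p₁` are never executed again. -/
theorem ComposeInv.concat {A₁ : SLocalAlg S Z₁ M₁} {A₂ : SLocalAlg (S × Z₁) Z₂ M₂} {z₀ : Z₁}
    {V : Type} [Fintype V] {I : Network b c V} {s : V → S} {p p₁ : List V}
    {mem mem' : V → Option (Z₂ × M₂ × (ℕ → Option (Z₁ × M₁)))}
    (h : ComposeInv A₁ A₂ I s p p₁ mem) {v : V} (hv : mem v = none)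
    (hself : mem' v = some (composeState A₁ A₂ z₀ V I (fun u => (s u, mem u)) v))
    (hne : ∀ u, u ≠ v → mem' u = mem u) : ∃ p₂, ComposeInv A₁ A₂ I s (p ++ [v]) p₂ mem' := by
  classical
  obtain ⟨p₂, hext, hrec, hnear⟩ := foldl_execAt_records A₁ h.nodup (h.records v)
    (List.range (I.N ^ c))
  replace hnear : ∀ u ∈ hopBall I.graph v (A₂.radius I.N), u ∈ p₂ := fun u hu =>
    hnear u hu (List.mem_range.2 (I.id_lt_N_pow u))
  change Records A₁ I s p₂ (A₂.radius I.N) v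
    (composeKnown A₁ A₂.radius I (fun u => (s u, mem u)) v) at hrec
  refine ⟨p₂, hext.nodup, ?_, ?_, ?_, ?_⟩
  · intro w g hg u a hga
    rcases eq_or_ne w v with rfl | hw
    · rw [hself] at hg
      cases hg
      exact hrec.sound u a hga
    · rw [hne w hw] at hg
      have := h.sound w g hg u a hga
      have hu : u ∈ p₁ := by
        by_contra hu
        rw [(A₁.run_eq_none_iff I s p₁ u).2 hu] at this
        cases this
      rw [hext.run_eq A₁ s hu, this]
  · intro u a hu
    have hup : u ∈ p₂ := by
      by_contra hup
      rw [(A₁.run_eq_none_iff I s p₂ u).2 hup] at hu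
      cases hu
    obtain ⟨q, rfl, hq⟩ := hext.exists_append
    rcases List.mem_append.1 hup with h1 | h1
    · rw [hext.run_eq A₁ s h1] at hu
      obtain ⟨w, hw, g, hg, hga⟩ := h.complete u a hu
      refine ⟨w, hw, g, ?_, hga⟩
      rw [hne w (fun hwv => by rw [hwv, hv] at hg; cases hg), hg]
    · refine ⟨v, mem_hopBall_symm (hq u h1), _, hself, ?_⟩
      rw [← hu]
      exact hrec.complete u (hopBall_mono (by omega) (hq u h1))
  · intro w hw u hu
    rcases List.mem_append.1 hw with hw | hw
    · exact hext.mem (h.near w hw u hu)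
    · rw [List.mem_singleton.1 hw] at hu
      exact hnear u hu
  -- The final first-stage outputs are not known yet, so the invariant covers every `z₁` compatible
  -- with the run so far; near `v` all its values are already determined and the default `z₀` is
  -- never used.
  · intro z₁ hz
    have ih := h.run_eq z₁ fun u hu => by rw [← hext.run_eq A₁ s hu]; exact hz u (hext.mem hu)
    funext u
    rcases eq_or_ne u v with rfl | hu
    · rw [A₂.run_concat_self, hself, ih]
      simp only [Option.map_some, composeState]
      congr 2
      refine Network.view_congr fun w hw => ?_
      have h1 := hz w (hnear w hw)
      rw [← hrec.complete w (hopBall_mono (by omega) hw)] at h1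
      obtain ⟨g, hg, hgz⟩ := Option.map_eq_some_iff.1 h1
      simp [hg, hgz]
    · rw [A₂.run_concat_of_ne _ _ _ hu, ih, hne u hu]

/-- The first algorithm is executed on demand. Its processing order is generated along the way,
which is harmless since it succeeds for every order. -/
theorem SeqSolves.comp {ρ₁ ρ₂ : ℕ → ℕ}
    {T₁ : ∀ (V : Type) [Fintype V], Network b c V → (V → S) → (V → Z₁) → Prop}
    {T₂ : ∀ (V : Type) [Fintype V], Network b c V → (V → S × Z₁) → (V → Z₂) → Prop}
    (h₁ : SeqSolves ρ₁ T₁) (h₂ : SeqSolves ρ₂ T₂) :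
    SeqSolves (fun N => ρ₁ N + 2 * ρ₂ N) fun V _ I s (z₂ : V → Z₂) =>
      ∃ z₁ : V → Z₁, T₁ V I s z₁ ∧ T₂ V I (fun v => (s v, z₁ v)) z₂ := by
  obtain ⟨M₁, A₁, rfl, h₁⟩ := h₁
  obtain ⟨M₂, A₂, rfl, h₂⟩ := h₂
  obtain ⟨z₀, -⟩ := A₁.nonempty_output
  obtain ⟨y₀, n₀⟩ := A₂.nonempty_output
  have : Nonempty (Z₂ × M₂ × (ℕ → Option (Z₁ × M₁))) := ⟨(y₀, n₀, fun _ => none)⟩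
  obtain ⟨step, hstep⟩ := (isLocal_composeState (b := b) (c := c) A₁ A₂ z₀).exists_step
  let A : SLocalAlg S Z₂ (M₂ × (ℕ → Option (Z₁ × M₁))) :=
    ⟨fun N => A₁.radius N + 2 * A₂.radius N, step⟩
  refine ⟨_, A, rfl, fun V _ _ I s order hord => ?_⟩
  have key : ∀ p : List V, p.Nodup → ∃ p₁, ComposeInv A₁ A₂ I s p p₁ (A.run I s p) := by
    intro p
    induction p using List.reverseRecOn with
    | nil =>
      intro _
      refine ⟨[], List.nodup_nil, ?_, ?_, ?_, ?_⟩ <;> simp [SLocalAlg.run]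
    | append_singleton p v ih =>
      intro hp
      obtain ⟨hp, -, hv⟩ := List.nodup_append.1 hp
      obtain ⟨p₁, h⟩ := ih hp
      refine h.concat (z₀ := z₀) ?_ ?_ ?_
      · rw [A.run_eq_none_iff]
        exact fun hm => hv v hm v (by simp) rfl
      · rw [A.run_concat_self]
        exact congrArg some (hstep V I _ v trivial)
      · exact fun u hu => A.run_concat_of_ne _ _ _ hu
  obtain ⟨p₁, h⟩ := key order hord.1
  -- Every node lies in its own ball, so the virtual order finally contains all nodes.
  have hp₁ : IsProcessingOrder p₁ :=
    ⟨h.nodup, fun v => h.near v (hord.2 v) v (mem_hopBall_self _ _)⟩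
  obtain ⟨z₁, hz₁, hT₁⟩ := h₁ V I s p₁ hp₁
  obtain ⟨z₂, hz₂, hT₂⟩ := h₂ V I (fun v => (s v, z₁ v)) order hord
  refine ⟨z₂, fun v => ?_, z₁, hT₁, hT₂⟩
  rw [← hz₂ v]
  unfold SLocalAlg.output
  rw [h.run_eq z₁ fun u _ => hz₁ u, Option.map_map]
  rfl

theorem SeqSolves.mono {S Z : Type} {ρ : ℕ → ℕ}
    {T T' : ∀ (V : Type) [Fintype V], Network b c V → (V → S) → (V → Z) → Prop}
    (h : SeqSolves ρ T)
    (hT : ∀ (V : Type) [Fintype V] [Nonempty V] (I : Network b c V) s z, T V I s z → T' V I s z) :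
    SeqSolves ρ T' := by
  obtain ⟨M, A, hA, h⟩ := h
  refine ⟨M, A, hA, fun V _ _ I s order ho => ?_⟩
  obtain ⟨z, hz, hT'⟩ := h V I s order ho
  exact ⟨z, hz, hT V I s z hT'⟩

/-- A quantity determined by the neighborhoods can be computed. -/
theorem IsLocal.seqSolves {S Z : Type} [Nonempty Z] {Q : StateProp b c S} {ρ : ℕ → ℕ}
    {Φ : NodeFun b c S Z} (h : IsLocal Q ρ Φ) :
    SeqSolves ρ fun V _ I s z => Q V I s → ∀ v, z v = Φ V I s v := by
  have h' : IsLocal (fun V _ I (s : V → S × Option (Z × Unit)) => Q V I fun v => (s v).1) ρ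
      fun V _ I s v => (Φ V I (fun v => (s v).1) v, ()) := by
    intro V V' _ _ I I' s s' v v' hQ hQ' hN hv
    simp only [Prod.mk.injEq, and_true]
    exact h V V' I I' _ _ v v' hQ hQ' hN
      (Network.view_comp hv _ _ fun u _ u' _ _ hs => by rw [hs])
  obtain ⟨step, hstep⟩ := h'.exists_step
  refine ⟨Unit, ⟨ρ, step⟩, rfl, fun V _ _ I s order hord => ?_⟩
  set A : SLocalAlg S Z Unit := ⟨ρ, step⟩
  have hsome : ∀ v, ∃ z, A.run I s order v = some z := fun v =>
    Option.ne_none_iff_exists'.1 fun h0 => (A.run_eq_none_iff I s order v).1 h0 (hord.2 v)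
  choose z hz using hsome
  refine ⟨fun v => (z v).1, fun v => by simp [SLocalAlg.output, hz], fun hQ v => ?_⟩
  obtain ⟨p, q, hpq⟩ := List.append_of_mem (hord.2 v)
  have hq : v ∉ q := by
    have := hord.1
    rw [hpq, List.nodup_append] at this
    exact (List.nodup_cons.1 this.2.1).1
  have hrun : A.run I s order v =
      some (step I.N (I.view (fun u => (s u, A.run I s p u)) (ρ I.N) v)) := by
    rw [hpq, show p ++ v :: q = (p ++ [v]) ++ q by simp, A.run_append_of_notMem _ _ _ _ hq,
      A.run_concat_self]
  rw [hz v, hstep V I _ v hQ] at hrun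
  exact congrArg Prod.fst (Option.some.inj hrun)

end Compose

/-! ### Random bit strings indexed by identifiers. -/

instance : IsProbabilityMeasure coinMeasure := by
  unfold coinMeasure; infer_instance

instance (V : Type) [Fintype V] : IsProbabilityMeasure (tapesMeasure V) := by
  unfold tapesMeasure; infer_instance

/-- The law of independent random bit strings, one for each possible identifier. -/
noncomputable def idTapesMeasure : Measure (ℕ → Tape) :=
  Measure.infinitePi fun _ : ℕ => coinMeasure

instance : IsProbabilityMeasure idTapesMeasure := by
  unfold idTapesMeasure; infer_instance

/-- Indexing bit strings by identifiers puts all networks on one probability space, so that events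
in networks with equal views can be compared outcome by outcome. -/
theorem measurePreserving_comp_injective {V : Type} [Fintype V] {f : V → ℕ}
    (hf : Function.Injective f) :
    MeasurePreserving (fun (ω : ℕ → Tape) v => ω (f v)) idTapesMeasure (tapesMeasure V) := by
  classical
  refine ⟨by fun_prop, ?_⟩
  unfold tapesMeasure
  refine (Measure.pi_eq fun t ht => ?_).symm
  rw [Measure.map_apply (by fun_prop) (MeasurableSet.univ_pi ht)]
  -- Identifiers not in use impose no constraint, so the preimage of a box is a box over finitely
  -- many coordinates.
  let t' : ℕ → Set Tape := fun i => if h : ∃ v, f v = i then t h.choose else Set.univ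
  have ht' : ∀ v, t' (f v) = t v := by
    intro v
    have h : ∃ w, f w = f v := ⟨v, rfl⟩
    simp only [t', dif_pos h]
    rw [hf h.choose_spec]
  have hpre : (fun (ω : ℕ → Tape) v => ω (f v)) ⁻¹' Set.univ.pi t =
      Set.pi ((Finset.univ.image f : Finset ℕ) : Set ℕ) t' := by
    ext ω
    simp [Set.mem_pi, ht']
  rw [hpre, idTapesMeasure, Measure.infinitePi_pi, Finset.prod_image (fun _ _ _ _ h => hf h)]
  · simp [ht']
  · intro i hi
    obtain ⟨v, -, rfl⟩ := Finset.mem_image.1 hi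
    rw [ht']
    exact ht v

/-- Resampling one coordinate independently does not change the product law. This is the Fubini step
behind conditioning on one bit string. -/
theorem measurePreserving_update_infinitePi {ι Ω : Type} [DecidableEq ι] [MeasurableSpace Ω]
    (μ : Measure Ω) [IsProbabilityMeasure μ] (i : ι) :
    MeasurePreserving (fun q : Ω × (ι → Ω) => Function.update q.2 i q.1)
      (μ.prod (Measure.infinitePi fun _ => μ)) (Measure.infinitePi fun _ => μ) := by
  have hm : Measurable fun q : Ω × (ι → Ω) => Function.update q.2 i q.1 := by
    refine measurable_pi_lambda _ fun j => ?_
    rcases eq_or_ne j i with rfl | h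
    · simpa using measurable_fst
    · simp only [Function.update_of_ne h]
      fun_prop
  refine ⟨hm, Measure.eq_infinitePi _ fun s t ht => ?_⟩
  rw [Measure.map_apply hm (MeasurableSet.pi s.countable_toSet fun j _ => ht j)]
  have hpre : (fun q : Ω × (ι → Ω) => Function.update q.2 i q.1) ⁻¹' Set.pi s t =
      (if i ∈ s then t i else Set.univ) ×ˢ Set.pi ((s.erase i : Finset ι) : Set ι) t := by
    ext ⟨a, ω⟩
    simp only [Set.mem_preimage, Set.mem_pi, Set.mem_prod, Finset.mem_coe, Finset.mem_erase]
    constructor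
    · intro h
      refine ⟨?_, fun j hj => ?_⟩
      · split_ifs with hi
        · simpa using h i hi
        · trivial
      · simpa [Function.update_of_ne hj.1] using h j hj.2
    · rintro ⟨h1, h2⟩ j hj
      rcases eq_or_ne j i with rfl | hne
      · simpa [hj] using h1
      · simpa [Function.update_of_ne hne] using h2 j ⟨hne, hj⟩
  rw [hpre, Measure.prod_prod, Measure.infinitePi_pi _ fun j _ => ht j]
  split_ifs with hi
  · rw [Finset.mul_prod_erase s (fun j => μ (t j)) hi]
  · rw [Finset.erase_eq_of_notMem hi, measure_univ, one_mul]

open Classical in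
theorem Network.Matches.sum_hopBall {b c : ℕ} {V V' : Type} [Fintype V] [Fintype V']
    {I : Network b c V} {I' : Network b c V'} {r : ℕ} {v : V} {v' : V'} (h : I.Matches I' r v v')
    (f : V → ENNReal) (f' : V' → ENNReal)
    (hf : ∀ u ∈ hopBall I.graph v r, ∀ u' ∈ hopBall I'.graph v' r, I.id u = I'.id u' →
      f u = f' u') :
    ∑ u with u ∈ hopBall I.graph v r, f u = ∑ u with u ∈ hopBall I'.graph v' r, f' u := by
  have hg : ∀ u (hu : u ∈ Finset.univ.filter (· ∈ hopBall I.graph v r)),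
      ∃ u' ∈ hopBall I'.graph v' r, I.id u = I'.id u' := fun u hu =>
    h.fwd u (Finset.mem_filter.1 hu).2
  refine Finset.sum_bij (fun u hu => (hg u hu).choose) (fun u hu => ?_) (fun u hu w hw huw => ?_)
    (fun u' hu' => ?_) (fun u hu => ?_)
  · exact Finset.mem_filter.2 ⟨Finset.mem_univ _, (hg u hu).choose_spec.1⟩
  · apply I.id_injective
    rw [(hg u hu).choose_spec.2, (hg w hw).choose_spec.2, huw]
  · obtain ⟨u, hu, huu⟩ := h.bwd u' (Finset.mem_filter.1 hu').2
    have hu₁ : u ∈ Finset.univ.filter (· ∈ hopBall I.graph v r) :=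
      Finset.mem_filter.2 ⟨Finset.mem_univ _, hu⟩
    refine ⟨u, hu₁, I'.id_injective ?_⟩
    rw [← (hg u hu₁).choose_spec.2, huu]
  · exact hf u (Finset.mem_filter.1 hu).2 _ (hg u hu).choose_spec.1 (hg u hu).choose_spec.2

/-! ### The method of conditional expectations. -/

section Derandomization

variable {b c : ℕ} {S : Type}

/-- The bit strings fixed in `m`, completed by those of `ω`. -/
def fillTapes {V : Type} [Fintype V] (I : Network b c V) (m : V → Option Tape) (ω : ℕ → Tape)
    (u : V) : Tape :=
  (m u).getD (ω (I.id u))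

/-- The conditional probability of the event `F` at `u`, given the bit strings fixed in `m`. -/
noncomputable def condProb (F : NodeFun b c (S × Tape) Prop) {V : Type} [Fintype V]
    (I : Network b c V) (s : V → S) (m : V → Option Tape) (u : V) : ENNReal :=
  idTapesMeasure {ω | F V I (fun w => (s w, fillTapes I m ω w)) u}

variable {Q : StateProp b c S} {ρ : ℕ → ℕ} {F : NodeFun b c (S × Tape) Prop}

theorem condProb_congr (hF : IsLocal (fun V _ I s => Q V I fun v => (s v).1) ρ F)
    {V V' : Type} [Fintype V] [Fintype V'] {I : Network b c V} {I' : Network b c V'}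
    {s : V → S} {s' : V' → S} {m : V → Option Tape} {m' : V' → Option Tape} {u : V} {u' : V'}
    (hQ : Q V I s) (hQ' : Q V' I' s') (hN : I.N = I'.N)
    (h : I.view (fun w => (s w, m w)) (ρ I.N) u = I'.view (fun w => (s' w, m' w)) (ρ I.N) u') :
    condProb F I s m u = condProb F I' s' m' u' := by
  unfold condProb
  congr 1
  ext ω
  have := hF V V' I I' (fun w => (s w, fillTapes I m ω w)) (fun w => (s' w, fillTapes I' m' ω w))
    u u' hQ hQ' hN (Network.view_comp h _ _ fun w _ w' _ hw hs => by
      rw [Prod.mk.injEq] at hs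
      simp only [fillTapes, hs.1, hs.2, hw])
  simp only [Set.mem_ofPred_eq, this]

theorem measurable_fillTapes {V : Type} [Fintype V] (I : Network b c V) (m : V → Option Tape) :
    Measurable (fillTapes I m) := by
  refine measurable_pi_lambda _ fun u => ?_
  unfold fillTapes
  cases m u
  · simpa using measurable_pi_apply _
  · simp

open Classical in
-- Law of total probability: fixing the string of `v` to `τ` has the same effect as overwriting
-- coordinate `I.id v` of `ω`, and averaging over `τ` resamples that coordinate.
theorem lintegral_condProb_update {V : Type} [Fintype V] {I : Network b c V} {s : V → S}
    {m : V → Option Tape} {u v : V} (hv : m v = none)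
    (hF : MeasurableSet {R : V → Tape | F V I (fun w => (s w, R w)) u}) :
    Measurable (fun τ => condProb F I s (Function.update m v (some τ)) u) ∧
    ∫⁻ τ, condProb F I s (Function.update m v (some τ)) u ∂coinMeasure = condProb F I s m u := by
  have hE : MeasurableSet {ω | F V I (fun w => (s w, fillTapes I m ω w)) u} :=
    measurable_fillTapes I m hF
  have hp := measurePreserving_update_infinitePi coinMeasure (I.id v)
  have hE' := hp.measurable hE
  have hsec : ∀ τ, condProb F I s (Function.update m v (some τ)) u =
      idTapesMeasure (Prod.mk τ ⁻¹' ((fun q : Tape × (ℕ → Tape) =>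
        Function.update q.2 (I.id v) q.1) ⁻¹'
          {ω | F V I (fun w => (s w, fillTapes I m ω w)) u})) := by
    intro τ
    unfold condProb
    congr 1
    ext ω
    have : fillTapes I (Function.update m v (some τ)) ω =
        fillTapes I m (Function.update ω (I.id v) τ) := by
      funext w
      unfold fillTapes
      rcases eq_or_ne w v with rfl | hw
      · simp [hv]
      · rw [Function.update_of_ne hw, Function.update_of_ne fun h => hw (I.id_injective h)]
    simp only [Set.mem_ofPred_eq, Set.mem_preimage, this]
  simp_rw [hsec]
  refine ⟨measurable_measure_prodMk_left hE', ?_⟩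
  rw [← Measure.prod_apply hE', idTapesMeasure, hp.measure_preimage hE.nullMeasurableSet]
  rfl

open Classical in
-- Some value is at most the mean.
theorem exists_sum_condProb_update_le {V : Type} [Fintype V] {I : Network b c V} {s : V → S}
    {m : V → Option Tape} {v : V} (hv : m v = none)
    (hF : ∀ u, MeasurableSet {R : V → Tape | F V I (fun w => (s w, R w)) u}) (B : Finset V) :
    ∃ τ, ∑ u ∈ B, condProb F I s (Function.update m v (some τ)) u ≤
      ∑ u ∈ B, condProb F I s m u := by
  have hm := fun u => lintegral_condProb_update hv (hF u)
  obtain ⟨τ, hτ⟩ := exists_le_lintegral (μ := coinMeasure)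
    (f := fun τ => ∑ u ∈ B, condProb F I s (Function.update m v (some τ)) u)
    (Finset.measurable_sum _ fun u _ => (hm u).1).aemeasurable
  refine ⟨τ, hτ.trans_eq ?_⟩
  rw [lintegral_finsetSum _ fun u _ => (hm u).1]
  exact Finset.sum_congr rfl fun u _ => (hm u).2

open Classical in
/-- A bit string for `v` that does not increase the conditional expectation of the number of events
near `v`. -/
noncomputable def goodTape (F : NodeFun b c (S × Tape) Prop) (ρ : ℕ → ℕ) :
    NodeFun b c (S × Option (Tape × Unit)) (Tape × Unit) :=
  fun _ _ I lab v => (Classical.epsilon fun τ =>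
    ∑ u with u ∈ hopBall I.graph v (ρ I.N), condProb F I (fun w => (lab w).1)
        (Function.update (fun w => (lab w).2.map Prod.fst) v (some τ)) u ≤
      ∑ u with u ∈ hopBall I.graph v (ρ I.N), condProb F I (fun w => (lab w).1)
        (fun w => (lab w).2.map Prod.fst) u, ())

/-- The events concerned are centered within `ρ` of `v`, and evaluating each takes another `ρ`. -/
theorem isLocal_goodTape (hF : IsLocal (fun V _ I s => Q V I fun v => (s v).1) ρ F) :
    IsLocal (fun V _ I lab => Q V I fun v => (lab v).1) (fun N => 2 * ρ N) (goodTape F ρ) := by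
  classical
  intro V V' _ _ I I' lab lab' v v' hQ hQ' hN h
  beta_reduce at h
  have hm := (Network.view_eq_iff.1 h).1
  have hm₁ : I.Matches I' (ρ I.N) v v' := hm.mono (by omega)
  unfold goodTape
  congr 2
  funext τ
  rw [← hN]
  rw [hm₁.sum_hopBall _ (fun u => condProb F I' (fun w => (lab' w).1)
      (Function.update (fun w => (lab' w).2.map Prod.fst) v' (some τ)) u), hm₁.sum_hopBall _
      (fun u => condProb F I' (fun w => (lab' w).1) (fun w => (lab' w).2.map Prod.fst) u)]
  · intro u hu u' hu' huu
    refine condProb_congr hF hQ hQ' hN ?_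
    exact Network.view_comp (Network.view_sub h (by omega) hu huu) _ _
      fun w _ w' _ _ hs => by rw [hs]
  · intro u hu u' hu' huu
    refine condProb_congr hF hQ hQ' hN ?_
    refine Network.view_comp (Network.view_sub h (by omega) hu huu) _ _
      fun w _ w' _ hww hs => ?_
    rw [hs]
    have : w = v ↔ w' = v' := by
      rw [← I.id_injective.eq_iff, ← I'.id_injective.eq_iff, hww, hm.id_eq]
    by_cases hwv : w = v
    · have hwv' := this.1 hwv
      subst hwv hwv'
      simp
    · rw [Function.update_of_ne hwv, Function.update_of_ne fun h => hwv (this.2 h), hs]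

/-- The method of conditional expectations: if the expected number of failure events, each of them
determined by the neighborhood of a node, is less than `1`, then bit strings without failures can
be found sequentially. -/
theorem seqSolves_of_sum_lt_one (hF : IsLocal (fun V _ I s => Q V I fun v => (s v).1) ρ F)
    (hmeas : ∀ (V : Type) [Fintype V] [Nonempty V] (I : Network b c V) (s : V → S), Q V I s →
      ∀ u, MeasurableSet {R : V → Tape | F V I (fun w => (s w, R w)) u})
    (hsum : ∀ (V : Type) [Fintype V] [Nonempty V] (I : Network b c V) (s : V → S), Q V I s →
      ∑ u, tapesMeasure V {R : V → Tape | F V I (fun w => (s w, R w)) u} < 1) :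
    SeqSolves (fun N => 2 * ρ N) fun V _ I s (z : V → Tape) =>
      Q V I s → ∀ u, ¬ F V I (fun w => (s w, z w)) u := by
  classical
  obtain ⟨step, hstep⟩ := (isLocal_goodTape hF).exists_step
  refine ⟨Unit, ⟨fun N => 2 * ρ N, step⟩, rfl, fun V _ _ I s order hord => ?_⟩
  set A : SLocalAlg S Tape Unit := ⟨fun N => 2 * ρ N, step⟩
  have hsome : ∀ v, ∃ z, A.output I s order v = some z := fun v => by
    obtain ⟨g, hg⟩ := Option.ne_none_iff_exists'.1 fun h0 =>
      (A.run_eq_none_iff I s order v).1 h0 (hord.2 v)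
    exact ⟨g.1, by simp [SLocalAlg.output, hg]⟩
  choose z hz using hsome
  refine ⟨z, hz, fun hQ => ?_⟩
  -- Invariant: the conditional expected number of failures stays below `1`.
  have key : ∀ p : List V, p.Nodup → ∑ u, condProb F I s (A.output I s p) u < 1 := by
    intro p
    induction p using List.reverseRecOn with
    | nil =>
      intro _
      refine lt_of_eq_of_lt (Finset.sum_congr rfl fun u _ => ?_) (hsum V I s hQ)
      rw [← (measurePreserving_comp_injective I.id_injective).measure_preimage
        (hmeas V I s hQ u).nullMeasurableSet]
      rfl
    | append_singleton p v ih =>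
      intro hp
      obtain ⟨hp, -, hv⟩ := List.nodup_append.1 hp
      refine lt_of_le_of_lt ?_ (ih hp)
      have hnone : A.output I s p v = none := by
        have := (A.run_eq_none_iff I s p v).2 fun hm => hv v hm v (by simp) rfl
        simp [SLocalAlg.output, this]
      set τ := (goodTape F ρ V I (fun u => (s u, A.run I s p u)) v).1 with hτ
      have hout : A.output I s (p ++ [v]) = Function.update (A.output I s p) v (some τ) := by
        funext u
        rcases eq_or_ne u v with rfl | hu
        · rw [Function.update_self, hτ, ← hstep V I _ u hQ]
          unfold SLocalAlg.output
          rw [A.run_concat_self]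
          rfl
        · rw [Function.update_of_ne hu]
          unfold SLocalAlg.output
          rw [A.run_concat_of_ne _ _ _ hu]
      rw [hout, ← Finset.sum_filter_add_sum_filter_not Finset.univ
        (· ∈ hopBall I.graph v (ρ I.N)), ← Finset.sum_filter_add_sum_filter_not Finset.univ
        (· ∈ hopBall I.graph v (ρ I.N)) (condProb F I s (A.output I s p))]
      -- Events near `v` are handled by the choice of `τ`; the others do not see `v` and keep their
      -- conditional probability.
      refine add_le_add ?_ (Finset.sum_le_sum fun u hu => ?_)
      · exact Classical.epsilon_spec (exists_sum_condProb_update_le hnone (hmeas V I s hQ) _)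
      · refine le_of_eq (condProb_congr hF hQ hQ rfl (Network.view_congr fun w hw => ?_))
        rw [Function.update_of_ne]
        rintro rfl
        exact (Finset.mem_filter.1 hu).2 (mem_hopBall_symm hw)
  intro u hu
  have hlt := key order hord.1
  -- With every string fixed nothing is random, so a failure that occurs has conditional probability
  -- `1`.
  have hone : condProb F I s (A.output I s order) u = 1 := by
    unfold condProb
    rw [show {ω | F V I (fun w => (s w, fillTapes I (A.output I s order) ω w)) u} = Set.univ from ?_,
      measure_univ]
    refine Set.eq_univ_of_forall fun ω => ?_
    simp only [Set.mem_ofPred_eq, fillTapes, hz, Option.getD_some]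
    exact hu
  refine absurd hlt (not_lt.2 ?_)
  rw [← hone]
  exact Finset.single_le_sum (f := fun u => condProb F I s (A.output I s order) u)
    (fun _ _ => zero_le) (Finset.mem_univ u)

end Derandomization

/-! ### Independence of single bits. -/

section Flip

/-- Flips one bit. -/
def flipBit (n : ℕ) (τ : Tape) : Tape := fun m => if m = n then !τ m else τ m

theorem measurePreserving_flipBit (n : ℕ) : MeasurePreserving (flipBit n) coinMeasure coinMeasure := by
  have hm : ∀ m : ℕ, Measurable fun β : Bool => if m = n then !β else β := fun m =>
    measurable_of_countable _
  refine ⟨measurable_pi_lambda _ fun m => (hm m).comp (measurable_pi_apply m), ?_⟩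
  unfold coinMeasure flipBit
  rw [Measure.infinitePi_map_pi _ hm]
  congr 1
  funext m
  split_ifs
  · ext s hs
    rw [Measure.map_apply (measurable_of_countable _) hs,
      PMF.toMeasure_apply_fintype _ _, PMF.toMeasure_apply_fintype _ _]
    simp only [Fintype.sum_bool, Set.indicator, Set.mem_preimage, PMF.uniformOfFintype_apply,
      Bool.not_true, Bool.not_false]
    rw [add_comm]
    rfl
  · exact Measure.map_id

variable {V : Type}

open Classical in
/-- Flips one bit of the bit string of `v`. -/
noncomputable def flipAt (v : V) (n : ℕ) (R : V → Tape) : V → Tape :=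
  fun w => if w = v then flipBit n (R w) else R w

theorem measurePreserving_flipAt [Fintype V] (v : V) (n : ℕ) :
    MeasurePreserving (flipAt v n) (tapesMeasure V) (tapesMeasure V) := by
  classical
  unfold tapesMeasure flipAt
  refine measurePreserving_pi (f := fun w τ => if w = v then flipBit n τ else τ) _ _ fun w => ?_
  split_ifs
  · exact measurePreserving_flipBit n
  · exact MeasurePreserving.id _

theorem measurableSet_bit (v : V) (n : ℕ) (β : Bool) : MeasurableSet {R : V → Tape | R v n = β} := by
  have : Measurable fun R : V → Tape => R v n := by fun_prop
  exact this (MeasurableSet.singleton β)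

/-- A bit is fair conditionally on an event that does not depend on it. -/
theorem measureReal_inter_bit [Fintype V] {E : Set (V → Tape)} (hE : MeasurableSet E) (v : V) (n : ℕ) (β : Bool)
    (h : ∀ R, flipAt v n R ∈ E ↔ R ∈ E) :
    (tapesMeasure V).real (E ∩ {R | R v n = β}) = (tapesMeasure V).real E / 2 := by
  -- The measure-preserving flip exchanges the two halves of `E`.
  have h1 : (tapesMeasure V).real (E ∩ {R | R v n = β}) =
      (tapesMeasure V).real (E \ {R | R v n = β}) := by
    rw [← (measurePreserving_flipAt v n).measureReal_preimage
      (hE.diff (measurableSet_bit v n β)).nullMeasurableSet]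
    congr 1
    ext R
    have : flipAt v n R v n = !R v n := by simp [flipAt, flipBit]
    simp only [Set.mem_inter_iff, Set.mem_preimage, Set.mem_sdiff, h, Set.mem_ofPred_eq, this]
    cases R v n <;> cases β <;> simp
  have h2 := measureReal_inter_add_sdiff (μ := tapesMeasure V) (s := E) (measurableSet_bit v n β)
  linarith

end Flip

/-! ### Random clustering with geometric ranges. -/

section Decomposition

/-- The geometric random variable number `i` of a bit string is at least `k`. -/
def GeoGe (τ : Tape) (i k : ℕ) : Prop := ∀ j < k, τ (Nat.pair i j) = true

theorem GeoGe.mono {τ : Tape} {i k l : ℕ} (h : GeoGe τ i k) (hl : l ≤ k) : GeoGe τ i l :=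
  fun j hj => h j (hj.trans_le hl)

theorem GeoGe.succ {τ : Tape} {i k : ℕ} (h : GeoGe τ i k) (hk : τ (Nat.pair i k) = true) :
    GeoGe τ i (k + 1) := fun j hj => by
  rcases Nat.lt_succ_iff_lt_or_eq.1 hj with hj | rfl
  exacts [h j hj, hk]

/-- Deciding whether variable `j` is at least `k` reads only the bits `Nat.pair j m` with `m < k`.
-/
theorem geoGe_flipAt {V : Type} {v w : V} {i j k l : ℕ} (R : V → Tape) (h : w ≠ v ∨ j ≠ i ∨ k ≤ l) :
    GeoGe (flipAt v (Nat.pair i l) R w) j k ↔ GeoGe (R w) j k := by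
  refine forall₂_congr fun m hm => ?_
  have : flipAt v (Nat.pair i l) R w (Nat.pair j m) = R w (Nat.pair j m) := by
    unfold flipAt
    split_ifs with hw
    · refine if_neg fun hp => ?_
      obtain ⟨rfl, rfl⟩ := Nat.pair_eq_pair.1 hp
      rcases h with h | h | h
      exacts [h hw, h rfl, absurd hm (by omega)]
    · rfl
  rw [this]

theorem measurable_geoGe {V : Type} (v : V) (i k : ℕ) : Measurable fun R : V → Tape => GeoGe (R v) i k := by
  unfold GeoGe
  refine Measurable.forall fun j => measurable_const.imp ?_
  exact measurableSet_setOfPred.1 (measurableSet_bit v _ true)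

variable {b c : ℕ} {V V' : Type} [Fintype V] [Fintype V']

theorem measureReal_geoGe (v : V) (i k : ℕ) :
    (tapesMeasure V).real {R | GeoGe (R v) i k} = (1 / 2) ^ k := by
  induction k with
  | zero => simp [GeoGe]
  | succ k ih =>
    have : {R : V → Tape | GeoGe (R v) i (k + 1)} =
        {R | GeoGe (R v) i k} ∩ {R | R v (Nat.pair i k) = true} := by
      ext R
      exact ⟨fun h => ⟨h.mono (by omega), h k (by omega)⟩, fun h => h.1.succ h.2⟩
    rw [this, measureReal_inter_bit (measurableSet_setOfPred.2 (measurable_geoGe v i k)), ih, pow_succ]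
    · ring
    · exact fun R => geoGe_flipAt R (Or.inr (Or.inr le_rfl))

/-- In phase `i`, with distances measured in units of `r` and ranges at most `B`, the node `v`
reaches the node `u` with slack `e`. -/
def Reaches (I : Network b c V) (r B : ℕ) (R : V → Tape) (i e : ℕ) (v u : V) : Prop :=
  ∃ k ≤ B, v ∈ hopBall I.graph u (r * k) ∧ GeoGe (R v) i (k + e)

/-- The node with the largest identifier among those that reach `u` is `v`. -/
def IsCenter (I : Network b c V) (r B : ℕ) (R : V → Tape) (i : ℕ) (u v : V) : Prop :=
  Reaches I r B R i 0 v u ∧ ∀ w, Reaches I r B R i 0 w u → I.id w ≤ I.id v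

/-- The node `u` joins the cluster of its center in phase `i`. -/
def Joins (I : Network b c V) (r B : ℕ) (R : V → Tape) (i : ℕ) (u : V) : Prop :=
  ∃ v, IsCenter I r B R i u v ∧ Reaches I r B R i 1 v u

theorem exists_isCenter (I : Network b c V) (r B : ℕ) (R : V → Tape) (i : ℕ) (u : V) :
    ∃ v, IsCenter I r B R i u v := by
  classical
  have hne : (Finset.univ.filter fun v => Reaches I r B R i 0 v u).Nonempty :=
    ⟨u, Finset.mem_filter.2 ⟨Finset.mem_univ _, 0, Nat.zero_le _, mem_hopBall_self _ _,
      fun j hj => absurd hj (by omega)⟩⟩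
  obtain ⟨v, hv, hmax⟩ := Finset.exists_max_image _ I.id hne
  exact ⟨v, (Finset.mem_filter.1 hv).2, fun w hw =>
    hmax w (Finset.mem_filter.2 ⟨Finset.mem_univ _, hw⟩)⟩

theorem IsCenter.unique {I : Network b c V} {r B : ℕ} {R : V → Tape} {i : ℕ} {u v w : V}
    (hv : IsCenter I r B R i u v) (hw : IsCenter I r B R i u w) : v = w :=
  I.id_injective (le_antisymm (hw.2 v hv.1) (hv.2 w hw.1))

theorem measurable_reaches (I : Network b c V) (r B i e : ℕ) (v u : V) :
    Measurable fun R : V → Tape => Reaches I r B R i e v u :=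
  Measurable.exists fun _ => measurable_const.and (measurable_const.and (measurable_geoGe v i _))

theorem measurable_isCenter (I : Network b c V) (r B i : ℕ) (u v : V) :
    Measurable fun R : V → Tape => IsCenter I r B R i u v :=
  (measurable_reaches I r B i 0 v u).and
    (Measurable.forall fun w => (measurable_reaches I r B i 0 w u).imp measurable_const)

theorem measurable_joins (I : Network b c V) (r B i : ℕ) (u : V) :
    Measurable fun R : V → Tape => Joins I r B R i u :=
  Measurable.exists fun v => (measurable_isCenter I r B i u v).and
    (measurable_reaches I r B i 1 v u)

/-- With probability at most `2 ^ (-i)`, the node `u` joins in none of the first `i` phases. -/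
theorem measureReal_forall_not_joins_le (I : Network b c V) (r B i : ℕ) (u : V) :
    (tapesMeasure V).real {R | ∀ j < i, ¬ Joins I r B R j u} ≤ (1 / 2) ^ i := by
  classical
  have hmeas : ∀ i, MeasurableSet {R : V → Tape | ∀ j < i, ¬ Joins I r B R j u} := fun i =>
    measurableSet_setOfPred.2 (Measurable.forall fun j =>
      measurable_const.imp (measurable_joins I r B j u).not)
  induction i with
  | zero => simp
  | succ i ih =>
    -- Condition on the identity of the center in phase `i`; these events are disjoint.
    let E : V → Set (V → Tape) := fun v =>
      {R | ∀ j < i, ¬ Joins I r B R j u} ∩ {R | IsCenter I r B R i u v}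
    have hE : ∀ v, MeasurableSet (E v) := fun v =>
      (hmeas i).inter (measurableSet_setOfPred.2 (measurable_isCenter I r B i u v))
    have hdisj : Pairwise (Function.onFun Disjoint E) := fun v w hvw =>
      Set.disjoint_left.2 fun R hv hw => hvw (hv.2.unique hw.2)
    have hhalf : ∀ v, (tapesMeasure V).real (E v ∩ {R | ¬ Reaches I r B R i 1 v u}) ≤
        (tapesMeasure V).real (E v) / 2 := by
      intro v
      by_cases hex : ∃ k, v ∈ hopBall I.graph u (r * k)
      -- Let `k` be the distance from `u` to `v` in units of `r`, rounded up. That `v` reaches `u`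
      -- depends only on the bits of `v` below `k` in this phase, and bit `k` alone decides about
      -- the spare unit: this is memorylessness.
      · obtain ⟨hk, hmin⟩ : v ∈ hopBall I.graph u (r * Nat.find hex) ∧
            ∀ k, v ∈ hopBall I.graph u (r * k) → Nat.find hex ≤ k :=
          ⟨Nat.find_spec hex, fun k => Nat.find_min' hex⟩
        generalize Nat.find hex = k at hk hmin
        rw [← measureReal_inter_bit (hE v) v (Nat.pair i k) false]
        · refine measureReal_mono ?_
          rintro R ⟨hR, hn⟩
          refine ⟨hR, ?_⟩
          by_contra hbit
          obtain ⟨l, hl, hvl, hgeo⟩ := hR.2.1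
          exact hn ⟨k, (hmin l hvl).trans hl, hk,
            (hgeo.mono (hmin l hvl)).succ (by simpa using hbit)⟩
        · intro R
          have h1 : ∀ j e w, j < i → (Reaches I r B (flipAt v (Nat.pair i k) R) j e w u ↔
              Reaches I r B R j e w u) := fun j e w hj =>
            exists_congr fun l => and_congr_right fun _ => and_congr_right fun _ =>
              geoGe_flipAt R (Or.inr (Or.inl hj.ne))
          have h2 : ∀ w, Reaches I r B (flipAt v (Nat.pair i k) R) i 0 w u ↔
              Reaches I r B R i 0 w u := by
            intro w
            by_cases hw : w = v
            · subst hw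
              constructor
              · rintro ⟨l, hl, hwl, hgeo⟩
                exact ⟨k, (hmin l hwl).trans hl, hk, (geoGe_flipAt R (Or.inr (Or.inr le_rfl))).1
                  (hgeo.mono (hmin l hwl))⟩
              · rintro ⟨l, hl, hwl, hgeo⟩
                exact ⟨k, (hmin l hwl).trans hl, hk, (geoGe_flipAt R (Or.inr (Or.inr le_rfl))).2
                  (hgeo.mono (hmin l hwl))⟩
            · exact exists_congr fun l => and_congr_right fun _ => and_congr_right fun _ =>
                geoGe_flipAt R (Or.inl hw)
          refine and_congr ?_ ?_
          · refine forall₂_congr fun j hj => ?_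
            simp only [Joins, IsCenter, h1 _ _ _ hj]
          · simp only [Set.mem_ofPred_eq, IsCenter, h2]
      · have : E v = ∅ := by
          refine Set.eq_empty_of_forall_notMem fun R hR => ?_
          obtain ⟨l, -, hvl, -⟩ := hR.2.1
          exact hex ⟨l, hvl⟩
        simp [this]
    have hsub : {R : V → Tape | ∀ j < i + 1, ¬ Joins I r B R j u} ⊆
        ⋃ v ∈ (Finset.univ : Finset V), E v ∩ {R | ¬ Reaches I r B R i 1 v u} := by
      intro R hR
      obtain ⟨v, hv⟩ := exists_isCenter I r B R i u
      simp only [Finset.mem_univ, Set.iUnion_true, Set.mem_iUnion]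
      exact ⟨v, ⟨fun j hj => hR j (by omega), hv⟩, fun hr => hR i (by omega) ⟨v, hv, hr⟩⟩
    calc (tapesMeasure V).real {R | ∀ j < i + 1, ¬ Joins I r B R j u}
        ≤ (tapesMeasure V).real (⋃ v ∈ (Finset.univ : Finset V),
            E v ∩ {R | ¬ Reaches I r B R i 1 v u}) := measureReal_mono hsub (measure_ne_top _ _)
      _ ≤ ∑ v, (tapesMeasure V).real (E v ∩ {R | ¬ Reaches I r B R i 1 v u}) :=
          measureReal_biUnion_finset_le _ _
      _ ≤ ∑ v, (tapesMeasure V).real (E v) / 2 := Finset.sum_le_sum fun v _ => hhalf v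
      _ = (tapesMeasure V).real (⋃ v ∈ (Finset.univ : Finset V), E v) / 2 := by
          rw [measureReal_biUnion_finset (fun v _ w _ h => hdisj h) fun v _ => hE v,
            Finset.sum_div]
      _ ≤ (tapesMeasure V).real {R | ∀ j < i, ¬ Joins I r B R j u} / 2 := by
          refine div_le_div_of_nonneg_right (measureReal_mono ?_) zero_le_two
          exact Set.iUnion₂_subset fun v _ => Set.inter_subset_left
      _ ≤ (1 / 2) ^ (i + 1) := by rw [pow_succ]; linarith

/-- A clustering with `K` colors: nodes of the same color within distance `r` are in the same
cluster, and clusters have weak diameter at most `D`. Nodes are labeled by color and cluster. -/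
structure IsDecomposition (I : Network b c V) (r K D : ℕ) (z : V → ℕ × ℕ) : Prop where
  color_lt : ∀ u, (z u).1 < K
  separated : ∀ u w, (z u).1 = (z w).1 → w ∈ hopBall I.graph u r → z u = z w
  diam_le : ∀ u w, z u = z w → w ∈ hopBall I.graph u D

/-- The clustering computed from random bits. -/
noncomputable def cluster (I : Network b c V) (r B : ℕ) (R : V → Tape) (u : V) : ℕ × ℕ :=
  (sInf {i | Joins I r B R i u},
    sInf {a | ∃ v, I.id v = a ∧ IsCenter I r B R (sInf {i | Joins I r B R i u}) u v})

/-- The node `u` reports that the clustering failed. -/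
def ClusterFails (I : Network b c V) (r K B : ℕ) (R : V → Tape) (u : V) : Prop :=
  (∃ i < K, GeoGe (R u) i (B + 1)) ∨ ∀ i < K, ¬ Joins I r B R i u

/-- A center that reaches `u` with a spare unit also reaches every node within `r` of `u`. Two
nearby nodes joining in the same phase are thus reached by each other's centers, and maximality of
identifiers forces the centers to coincide. -/
theorem isDecomposition_cluster {I : Network b c V} {r K B : ℕ} {R : V → Tape}
    (h : ∀ u, ¬ ClusterFails I r K B R u) :
    IsDecomposition I r K (2 * (r * B)) (cluster I r B R) := by
  have hgeo : ∀ u, ∀ i < K, ¬ GeoGe (R u) i (B + 1) := fun u i hi hg => h u (Or.inl ⟨i, hi, hg⟩)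
  have hjoin : ∀ u, (cluster I r B R u).1 < K ∧ ∃ v, IsCenter I r B R (cluster I r B R u).1 u v ∧
      Reaches I r B R (cluster I r B R u).1 1 v u ∧ (cluster I r B R u).2 = I.id v := by
    intro u
    have hex : ∃ i < K, Joins I r B R i u := by
      by_contra hcon
      push Not at hcon
      exact h u (Or.inr hcon)
    obtain ⟨i, hi, hij⟩ := hex
    have hmem : Joins I r B R (cluster I r B R u).1 u :=
      Nat.sInf_mem (s := {i | Joins I r B R i u}) ⟨i, hij⟩
    refine ⟨(Nat.sInf_le (show i ∈ {i | Joins I r B R i u} from hij)).trans_lt hi, ?_⟩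
    obtain ⟨v, hv, hr⟩ := hmem
    refine ⟨v, hv, hr, ?_⟩
    obtain ⟨w, hw, hwc⟩ : (cluster I r B R u).2 ∈
        {a | ∃ v, I.id v = a ∧ IsCenter I r B R (cluster I r B R u).1 u v} :=
      Nat.sInf_mem ⟨_, v, rfl, hv⟩
    rw [← hw, hwc.unique hv]
  have hmax : ∀ u w v x i, i < K → w ∈ hopBall I.graph u r → Reaches I r B R i 1 v u →
      IsCenter I r B R i w x → I.id v ≤ I.id x := by
    rintro u w v x i hi hw ⟨k, hk, hv, hg⟩ hx
    -- The cap on ranges is harmless here: no range exceeds `B`, so the spare unit still fits.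
    have hkB : k + 1 ≤ B := by
      by_contra hcon
      exact hgeo v i hi (hg.mono (by omega))
    refine hx.2 v ⟨k + 1, hkB, ?_, hg⟩
    exact hopBall_mono (by rw [mul_add]; omega) (mem_hopBall_trans (mem_hopBall_symm hw) hv)
  refine ⟨fun u => (hjoin u).1, fun u w huw hw => ?_, fun u w huw => ?_⟩
  · obtain ⟨hK, v, hv, hvr, hvi⟩ := hjoin u
    obtain ⟨-, x, hx, hxr, hxi⟩ := hjoin w
    rw [← huw] at hx hxr
    refine Prod.ext huw ?_
    rw [hvi, hxi]
    exact le_antisymm (hmax u w v x _ hK hw hvr hx) (hmax w u x v _ hK (mem_hopBall_symm hw) hxr hv)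
  · obtain ⟨-, v, -, ⟨k, hk, hv, -⟩, hvi⟩ := hjoin u
    obtain ⟨-, x, -, ⟨l, hl, hx, -⟩, hxi⟩ := hjoin w
    obtain rfl : v = x := I.id_injective (by rw [← hvi, ← hxi, huw])
    have hk' := Nat.mul_le_mul_left r hk
    have hl' := Nat.mul_le_mul_left r hl
    exact hopBall_mono (by omega) (mem_hopBall_trans hv (mem_hopBall_symm hx))

theorem measurableSet_clusterFails (I : Network b c V) (r K B : ℕ) (u : V) :
    MeasurableSet {R : V → Tape | ClusterFails I r K B R u} :=
  measurableSet_setOfPred.2 <| Measurable.or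
    (Measurable.exists fun i => measurable_const.and (measurable_geoGe u i _))
    (Measurable.forall fun i => measurable_const.imp (measurable_joins I r B i u).not)

theorem measureReal_clusterFails_le (I : Network b c V) (r K B : ℕ) (u : V) :
    (tapesMeasure V).real {R : V → Tape | ClusterFails I r K B R u} ≤
      K * (1 / 2) ^ (B + 1) + (1 / 2) ^ K := by
  have hsub : {R : V → Tape | ClusterFails I r K B R u} ⊆
      (⋃ i ∈ Finset.range K, {R | GeoGe (R u) i (B + 1)}) ∪
        {R | ∀ i < K, ¬ Joins I r B R i u} := by
    rintro R (⟨i, hi, h⟩ | h)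
    · left
      simp only [Finset.mem_range, Set.mem_iUnion]
      exact ⟨i, hi, h⟩
    · exact Or.inr h
  refine (measureReal_mono hsub).trans ((measureReal_union_le _ _).trans (add_le_add ?_ ?_))
  · refine (measureReal_biUnion_finset_le _ _).trans ?_
    simp [measureReal_geoGe]
  · exact measureReal_forall_not_joins_le I r B K u

/-- The number of bits of `N`. -/
def logN (N : ℕ) : ℕ := Nat.log 2 N + 1

/-- With `L = logN N` we have `n < 2 ^ L` and `L + 1 ≤ 2 ^ L`. The choices `K = L + 1` and `B = 2 *
L` make each of the two failure causes contribute less than `1/2` in total over all nodes. -/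
theorem sum_measureReal_clusterFails_lt_one [Nonempty V] (I : Network b c V) (r : ℕ) :
    ∑ u, (tapesMeasure V).real
      {R : V → Tape | ClusterFails I r (logN I.N + 1) (2 * logN I.N) R u} < 1 := by
  set L := logN I.N with hL
  refine (Finset.sum_le_sum fun u _ =>
    measureReal_clusterFails_le I r (L + 1) (2 * L) u).trans_lt ?_
  rw [Finset.sum_const, nsmul_eq_mul, Finset.card_univ]
  have hn : (Fintype.card V : ℝ) < 2 ^ L := by
    exact_mod_cast I.card_le.trans_lt (Nat.lt_pow_succ_log_self (by norm_num) I.N)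
  have hLp : ((L + 1 : ℕ) : ℝ) ≤ 2 ^ L := by exact_mod_cast Nat.lt_two_pow_self
  have hx : (0 : ℝ) < (1 / 2) ^ L := by positivity
  have hxy : (1 / 2 : ℝ) ^ L * 2 ^ L = 1 := by rw [← mul_pow]; norm_num
  rw [pow_succ, pow_succ, mul_comm 2 L, pow_mul]
  set x : ℝ := (1 / 2) ^ L
  have h1 : ((L + 1 : ℕ) : ℝ) * x ≤ 1 := by
    rw [← hxy, mul_comm]; exact mul_le_mul_of_nonneg_left hLp hx.le
  have h2 : (Fintype.card V : ℝ) * x < 1 := by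
    rw [← hxy, mul_comm]; exact mul_lt_mul_of_pos_left hn hx
  have h3 : (Fintype.card V : ℝ) * x * (((L + 1 : ℕ) : ℝ) * x) ≤ (Fintype.card V : ℝ) * x :=
    mul_le_of_le_one_right (by positivity) h1
  nlinarith

/-- The cap `B` confines all relevant centers to the ball of radius `r * B`. -/
theorem reaches_congr {I : Network b c V} {I' : Network b c V'} {r B : ℕ} {R : V → Tape}
    {R' : V' → Tape} {u v : V} {u' v' : V'} {i e : ℕ}
    (h : I.view R (r * B) u = I'.view R' (r * B) u') (hv : I.id v = I'.id v') :
    Reaches I r B R i e v u ↔ Reaches I' r B R' i e v' u' := by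
  obtain ⟨hm, hs⟩ := Network.view_eq_iff.1 h
  refine exists_congr fun k => and_congr_right fun hk => ?_
  have hk := Nat.mul_le_mul_left r hk
  constructor
  · rintro ⟨h1, h2⟩
    have h1' := hm.mem_hopBall hk h1 hv
    exact ⟨h1', by rwa [← hs v (hopBall_mono hk h1) v' (hopBall_mono hk h1') hv]⟩
  · rintro ⟨h1, h2⟩
    have h1' := hm.symm.mem_hopBall hk h1 hv.symm
    exact ⟨h1', by rwa [hs v (hopBall_mono hk h1') v' (hopBall_mono hk h1) hv]⟩

theorem Reaches.exists_corr {I : Network b c V} {I' : Network b c V'} {r B : ℕ} {R : V → Tape}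
    {R' : V' → Tape} {u v : V} {u' : V'} {i e : ℕ} (hr : Reaches I r B R i e v u)
    (h : I.view R (r * B) u = I'.view R' (r * B) u') : ∃ v', I.id v = I'.id v' := by
  obtain ⟨k, hk, hv, -⟩ := hr
  obtain ⟨v', -, hv'⟩ := (Network.view_eq_iff.1 h).1.exists_corr (Nat.mul_le_mul_left r hk) hv
  exact ⟨v', hv'⟩

theorem isCenter_congr {I : Network b c V} {I' : Network b c V'} {r B : ℕ} {R : V → Tape}
    {R' : V' → Tape} {u v : V} {u' v' : V'} {i : ℕ}
    (h : I.view R (r * B) u = I'.view R' (r * B) u') (hv : I.id v = I'.id v') :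
    IsCenter I r B R i u v ↔ IsCenter I' r B R' i u' v' := by
  refine and_congr (reaches_congr h hv) ⟨fun hc w' hw' => ?_, fun hc w hw => ?_⟩
  · obtain ⟨w, hw⟩ := hw'.exists_corr h.symm
    rw [hw, ← hv]
    exact hc w ((reaches_congr h hw.symm).2 hw')
  · obtain ⟨w', hw'⟩ := hw.exists_corr h
    rw [hw', hv]
    exact hc w' ((reaches_congr h hw').1 hw)

theorem joins_congr {I : Network b c V} {I' : Network b c V'} {r B : ℕ} {R : V → Tape}
    {R' : V' → Tape} {u : V} {u' : V'} {i : ℕ}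
    (h : I.view R (r * B) u = I'.view R' (r * B) u') :
    Joins I r B R i u ↔ Joins I' r B R' i u' := by
  constructor
  · rintro ⟨v, hv, hr⟩
    obtain ⟨v', hv'⟩ := hr.exists_corr h
    exact ⟨v', (isCenter_congr h hv').1 hv, (reaches_congr h hv').1 hr⟩
  · rintro ⟨v', hv', hr⟩
    obtain ⟨v, hv⟩ := hr.exists_corr h.symm
    exact ⟨v, (isCenter_congr h hv.symm).2 hv', (reaches_congr h hv.symm).2 hr⟩

theorem cluster_congr {I : Network b c V} {I' : Network b c V'} {r B : ℕ} {R : V → Tape}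
    {R' : V' → Tape} {u : V} {u' : V'} (h : I.view R (r * B) u = I'.view R' (r * B) u') :
    cluster I r B R u = cluster I' r B R' u' := by
  unfold cluster
  simp only [joins_congr h]
  congr 2
  ext a
  constructor
  · rintro ⟨v, rfl, hv⟩
    obtain ⟨v', hv'⟩ := hv.1.exists_corr h
    exact ⟨v', hv'.symm, (isCenter_congr h hv').1 hv⟩
  · rintro ⟨v', rfl, hv'⟩
    obtain ⟨v, hv⟩ := hv'.1.exists_corr h.symm
    exact ⟨v, hv.symm, (isCenter_congr h hv.symm).2 hv'⟩

theorem clusterFails_congr {I : Network b c V} {I' : Network b c V'} {r K B : ℕ} {R : V → Tape}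
    {R' : V' → Tape} {u : V} {u' : V'} (h : I.view R (r * B) u = I'.view R' (r * B) u') :
    ClusterFails I r K B R u ↔ ClusterFails I' r K B R' u' := by
  obtain ⟨hm, hs⟩ := Network.view_eq_iff.1 h
  unfold ClusterFails
  simp only [joins_congr h, hs u (mem_hopBall_self _ _) u' (mem_hopBall_self _ _) hm.id_eq]

end Decomposition

/-! ### Simulation along a colored clustering. -/

namespace Network

variable {b c : ℕ} {V V' : Type} [Fintype V] [Fintype V']

/-- Quantities determined by neighborhoods of radius `j` can be added to the states, at the cost of
reducing the radius by `j`. -/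
theorem view_extend {I : Network b c V} {I' : Network b c V'} {L L' : Type} {s : V → L}
    {s' : V' → L} {k j : ℕ} {v : V} {v' : V'} (h : I.view s (k + j) v = I'.view s' (k + j) v')
    (t : V → L') (t' : V' → L')
    (ht : ∀ u u', I.view s j u = I'.view s' j u' → t u = t' u') :
    I.view (fun u => (s u, t u)) k v = I'.view (fun u => (s' u, t' u)) k v' := by
  have hm := (view_eq_iff.1 h).1
  refine view_comp (view_sub (k := 0) (j := k) h (by omega) (mem_hopBall_self _ _) hm.id_eq)
    _ _ fun u hu u' _ huu hs => ?_
  rw [hs, ht u u' (view_sub h le_rfl hu huu)]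

end Network

theorem IsLocal.mono {b c : ℕ} {L Z : Type} {Q : StateProp b c L} {ρ σ : ℕ → ℕ}
    {Φ : NodeFun b c L Z} (h : IsLocal Q ρ Φ) (hσ : ∀ N, ρ N ≤ σ N) : IsLocal Q σ Φ :=
  fun V V' _ _ I I' s s' v v' hQ hQ' hN hv => h V V' I I' s s' v v' hQ hQ' hN
    (Network.view_sub (k := 0) hv (by have := hσ I.N; omega) (mem_hopBall_self _ _)
      (Network.view_eq_iff.1 hv).1.id_eq)

section Simulation

variable {b c : ℕ} {V V' : Type} [Fintype V] [Fintype V']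

/-- Nodes are compared by color, then by identifier. -/
def orderKey (I : Network b c V) (z : V → ℕ × ℕ) (u : V) : ℕ ×ₗ ℕ := toLex ((z u).1, I.id u)

theorem exists_colorOrder (I : Network b c V) (z : V → ℕ × ℕ) :
    ∃ l : List V, IsProcessingOrder l ∧
      l.Pairwise fun u w => orderKey I z u < orderKey I z w := by
  classical
  have hinj : Function.Injective (orderKey I z) := fun u w h => by
    have := toLex.injective h
    exact I.id_injective (Prod.ext_iff.1 this).2
  let le : V → V → Bool := fun u w => decide (orderKey I z u ≤ orderKey I z w)
  have hs : ((Finset.univ : Finset V).toList.mergeSort le).Pairwise fun u w => le u w = true :=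
    List.pairwise_mergeSort
      (fun u v w h1 h2 => decide_eq_true ((of_decide_eq_true h1).trans (of_decide_eq_true h2)))
      (fun u w => by simpa [le] using le_total _ _) _
  have hperm := List.mergeSort_perm (Finset.univ : Finset V).toList le
  have hnd := hperm.nodup_iff.2 (Finset.nodup_toList _)
  refine ⟨_, ⟨hnd, fun v => hperm.mem_iff.2 (by simp)⟩, ?_⟩
  refine (hs.and hnd).imp fun h => ?_
  exact lt_of_le_of_ne (of_decide_eq_true h.1) fun he => h.2 (hinj he)

/-- All nodes, ordered by color, then by identifier. -/
noncomputable def colorOrder (I : Network b c V) (z : V → ℕ × ℕ) : List V :=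
  (exists_colorOrder I z).choose

theorem isProcessingOrder_colorOrder (I : Network b c V) (z : V → ℕ × ℕ) :
    IsProcessingOrder (colorOrder I z) := (exists_colorOrder I z).choose_spec.1

variable {X Y M : Type}

open Classical in
-- A recursive equation for the run: the state of `v` depends on nearby states with smaller key
-- only. It replaces the global list by a well-founded recursion.
theorem run_colorOrder (A : SLocalAlg X Y M) (I : Network b c V) (x : V → X) (z : V → ℕ × ℕ)
    (v : V) : A.run I x (colorOrder I z) v = some (A.step I.N (I.view (fun u => (x u,
      if orderKey I z u < orderKey I z v then A.run I x (colorOrder I z) u else none))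
        (A.radius I.N) v)) := by
  have hpw := (exists_colorOrder I z).choose_spec.2
  have hord := isProcessingOrder_colorOrder I z
  change (colorOrder I z).Pairwise _ at hpw
  obtain ⟨p, q, hpq⟩ := List.append_of_mem (hord.2 v)
  have hnd := hord.1
  have hmem := hord.2
  rw [hpq] at hpw hnd hmem ⊢
  rw [List.pairwise_append, List.pairwise_cons] at hpw
  rw [List.nodup_append, List.nodup_cons] at hnd
  have hrun : ∀ u, u ∉ q → A.run I x (p ++ v :: q) u = A.run I x (p ++ [v]) u := by
    intro u hu
    rw [show p ++ v :: q = (p ++ [v]) ++ q by simp, A.run_append_of_notMem _ _ _ _ hu]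
  rw [hrun v hnd.2.1.1, A.run_concat_self]
  congr 2
  refine Network.view_congr fun u _ => ?_
  congr 1
  by_cases hup : u ∈ p
  · rw [if_pos (hpw.2.2 u hup v (by simp)), A.run_append_of_notMem]
    exact fun h => hnd.2.2 u hup u h rfl
  · rw [if_neg, (A.run_eq_none_iff I x p u).2 hup]
    rcases List.mem_append.1 (hmem u) with h | h
    · exact absurd h hup
    · rcases List.mem_cons.1 h with rfl | h
      · exact lt_irrefl _
      · exact (hpw.2.1.1 u h).asymm

/-- The radius is measured from an anchor `a` in the cluster of `v`. Dependencies within the same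
color stay in this cluster and cost nothing extra. A dependency of smaller color lies within `D + ρ`
of `a` and becomes the new anchor, with a radius smaller by at least `D + ρ`. -/
theorem run_colorOrder_congr (A : SLocalAlg X Y M) {I : Network b c V} {I' : Network b c V'}
    {x : V → X} {x' : V' → X} {z : V → ℕ × ℕ} {z' : V' → ℕ × ℕ} (hN : I.N = I'.N) {K D : ℕ}
    (hz : IsDecomposition I (A.radius I.N) K D z) {v a : V} {v' a' : V'} (hva : z v = z a)
    (h : I.view (fun u => (x u, z u)) (((z a).1 + 1) * (D + A.radius I.N)) a =
      I'.view (fun u => (x' u, z' u)) (((z a).1 + 1) * (D + A.radius I.N)) a')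
    (hvv : I.id v = I'.id v') :
    A.run I x (colorOrder I z) v = A.run I' x' (colorOrder I' z') v' := by
  classical
  induction hk : orderKey I z v using WellFoundedLT.induction generalizing v a v' a' with
  | ind k ih =>
  subst hk
  set ρ := A.radius I.N with hρ
  have hT : D + ρ ≤ ((z a).1 + 1) * (D + ρ) := Nat.le_mul_of_pos_left _ (Nat.succ_pos _)
  have hv : v ∈ hopBall I.graph a D := hz.diam_le a v hva.symm
  have hview := Network.view_sub h hT hv hvv
  have hvz : z v = z' v' := by
    have := (Network.view_eq_iff.1 hview).2 v (mem_hopBall_self _ _) v' (mem_hopBall_self _ _) hvv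
    exact (Prod.ext_iff.1 this).2
  rw [run_colorOrder, run_colorOrder, ← hN]
  congr 2
  refine Network.view_comp hview _ _ fun w hw w' hw' hww hs => ?_
  rw [Prod.mk.injEq] at hs
  rw [hs.1]
  congr 1
  have hkw : orderKey I z w = orderKey I' z' w' := by simp [orderKey, hs.2, hww]
  have hkv : orderKey I z v = orderKey I' z' v' := by simp [orderKey, hvz, hvv]
  rw [← hkw, ← hkv]
  split_ifs with hlt
  -- Smaller color: re-anchor at `w`. Equal color: separation puts `w` in the cluster of `v`, so the
  -- anchor `a` is kept.
  · rcases Prod.Lex.lt_iff.1 hlt with hc | ⟨hc, -⟩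
    · have hc : (z w).1 + 1 ≤ (z a).1 := by rw [← hva]; exact hc
      refine ih _ hlt rfl (Network.view_sub h ?_ (mem_hopBall_trans hv hw) hww) hww rfl
      have := Nat.mul_le_mul_right (D + ρ) (show (z w).1 + 1 + 1 ≤ (z a).1 + 1 by omega)
      rw [Nat.succ_mul ((z w).1 + 1)] at this
      omega
    · exact ih _ hlt ((hz.separated v w hc.symm hw).symm.trans hva) h hww rfl
  · rfl

/-- The output of `A` when the nodes are processed by color, the states being inputs with colors
and clusters. -/
noncomputable def simOutput (A : SLocalAlg X Y M) (y₀ : Y) : NodeFun b c (X × (ℕ × ℕ)) Y :=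
  fun _ _ I s v =>
    (A.output I (fun u => (s u).1) (colorOrder I fun u => (s u).2) v).getD y₀

theorem isLocal_simOutput (A : SLocalAlg X Y M) (y₀ : Y) (K D : ℕ → ℕ) :
    IsLocal (fun _ _ I s => IsDecomposition I (A.radius I.N) (K I.N) (D I.N) fun u => (s u).2)
      (fun N => K N * (D N + A.radius N)) (simOutput (b := b) (c := c) A y₀) := by
  intro V V' _ _ I I' s s' v v' hQ _ hN h
  beta_reduce at h
  have hm := (Network.view_eq_iff.1 h).1
  unfold simOutput SLocalAlg.output
  rw [run_colorOrder_congr A hN hQ rfl (Network.view_sub (k := 0) h ?_ (mem_hopBall_self _ _)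
    hm.id_eq) hm.id_eq]
  rw [zero_add]
  exact Nat.mul_le_mul_right _ (hQ.color_lt v)

theorem output_eq_simOutput (A : SLocalAlg X Y M) (y₀ : Y) (I : Network b c V)
    (s : V → X × (ℕ × ℕ)) (v : V) :
    A.output I (fun u => (s u).1) (colorOrder I fun u => (s u).2) v =
      some (simOutput A y₀ V I s v) := by
  obtain ⟨g, hg⟩ := Option.ne_none_iff_exists'.1 fun h0 =>
    (A.run_eq_none_iff I (fun u => (s u).1) (colorOrder I fun u => (s u).2) v).1 h0
      ((isProcessingOrder_colorOrder I _).2 v)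
  simp [simOutput, SLocalAlg.output, hg]

end Simulation

/-! ### Relations between the complexity classes. -/

section Classes

variable {b c : ℕ} {X Y : Type}

theorem sum_measure_lt_one_of_real {V : Type} [Fintype V] {E : V → Set (V → Tape)}
    (h : ∑ v, (tapesMeasure V).real (E v) < 1) : ∑ v, tapesMeasure V (E v) < 1 := by
  have h1 : ∑ v, tapesMeasure V (E v) ≠ ⊤ := ENNReal.sum_ne_top.2 fun v _ => measure_ne_top _ _
  rw [← ENNReal.toReal_lt_toReal h1 ENNReal.one_ne_top,
    ENNReal.toReal_sum fun v _ => measure_ne_top _ _]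
  simpa [Measure.real] using h

theorem SeqSolves.mem_SLOCAL {P : DistProblem X Y} {ρ t : ℕ → ℕ}
    (h : SeqSolves (b := b) (c := c) ρ fun _ _ I x y => P.spec I.graph x y)
    (ht : RadiusBound b ρ t) : P ∈ SLOCAL b c t := by
  obtain ⟨M, A, rfl, h⟩ := h
  exact ⟨M, A, ht, fun V _ _ I x order ho => h V I x order ho⟩

theorem LocalAlg.output_congr (A : LocalAlg X Y) {V V' : Type} [Fintype V] [Fintype V']
    {I : Network b c V} {I' : Network b c V'} {s : V → X} {s' : V' → X} {v : V} {v' : V'}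
    (hN : I.N = I'.N) (h : I.view s (A.radius I.N) v = I'.view s' (A.radius I.N) v') :
    A.output I s v = A.output I' s' v' := by
  unfold LocalAlg.output
  rw [h, hN]

theorem LocalAlg.nonempty_output (A : LocalAlg X Y) : Nonempty Y :=
  ⟨A.decide 0 ⟨0, fun _ => none, fun _ _ => False⟩⟩

/-- Finding bit strings that raise no flag takes radius `2 * t`; evaluating the LOCAL algorithm on
them as a second stage adds twice its radius. -/
theorem ZLOCAL_subset_SLOCAL (t : ℕ → ℕ) :
    (ZLOCAL b c t : Set (DistProblem X Y)) ⊆ SLOCAL b c fun n => 4 * t n := by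
  rintro P ⟨A, hA, h⟩
  obtain ⟨y₀, -⟩ := A.nonempty_output
  have : Nonempty Y := ⟨y₀⟩
  have hloc : IsLocal (b := b) (c := c) (fun _ _ _ _ => True) A.radius
      fun _ _ I s v => (A.output I s v).2 = true := by
    intro V V' _ _ I I' s s' v v' _ _ hN hv
    beta_reduce
    rw [A.output_congr hN hv]
  have hout : IsLocal (b := b) (c := c) (fun _ _ _ _ => True) A.radius
      fun _ _ I s v => (A.output I s v).1 := by
    intro V V' _ _ I I' s s' v v' _ _ hN hv
    beta_reduce
    rw [A.output_congr hN hv]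
  have h₁ := seqSolves_of_sum_lt_one (Q := fun _ _ _ _ => True) hloc
    (fun V _ _ I x _ u => (h V I x).2.1 u)
    (fun V _ _ I x _ => sum_measure_lt_one_of_real (h V I x).2.2)
  refine ((h₁.comp hout.seqSolves).mono ?_).mem_SLOCAL ?_
  · rintro V _ _ I x y ⟨z, hz, hy⟩
    rw [funext (hy trivial)]
    exact (h V I x).1 z fun v => by simpa using hz trivial v
  · intro n N hn hnN hN
    have := hA n N hn hnN hN
    dsimp only
    omega

/-- The radius that suffices for simulating a SLOCAL algorithm of locality `ρ` on a random
clustering. -/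
def simRadius (ρ : ℕ → ℕ) (N : ℕ) : ℕ :=
  (logN N + 1) * (2 * (ρ N * (2 * logN N)) + ρ N)

theorem one_le_logN (N : ℕ) : 1 ≤ logN N := Nat.succ_pos _

theorem simRadius_le (ρ : ℕ → ℕ) (N : ℕ) : simRadius ρ N ≤ 10 * (ρ N * logN N ^ 2) := by
  unfold simRadius
  have h := one_le_logN N
  generalize logN N = L at h
  have h1 : L + 1 ≤ 2 * L := by omega
  have h2 : 2 * (ρ N * (2 * L)) + ρ N ≤ 5 * (ρ N * L) := by nlinarith [Nat.zero_le (ρ N)]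
  calc _ ≤ (2 * L) * (5 * (ρ N * L)) := Nat.mul_le_mul h1 h2
    _ = _ := by ring

theorem clusterRadius_le (ρ : ℕ → ℕ) (N : ℕ) : ρ N * (2 * logN N) ≤ 2 * (ρ N * logN N ^ 2) := by
  have h := one_le_logN N
  generalize logN N = L at h
  nlinarith [Nat.mul_le_mul_left (ρ N * L) h]

/-- Cluster at random, then simulate in color order; the flags report clustering failures. The
factor is `10` for the simulation plus `2` for the clustering, and `n ^ b` appears because only `N ≤
n ^ b` is known. -/
theorem SLOCAL_subset_ZLOCAL (t : ℕ → ℕ) :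
    (SLOCAL b c t : Set (DistProblem X Y)) ⊆
      ZLOCAL b c fun n => 12 * (t n * logN (n ^ b) ^ 2) := by
  rintro P ⟨M, A, hA, h⟩
  obtain ⟨y₀, -⟩ := A.nonempty_output
  have : Nonempty Y := ⟨y₀⟩
  let rB : ℕ → ℕ := fun N => A.radius N * (2 * logN N)
  let ρ : ℕ → ℕ := fun N => simRadius A.radius N + rB N
  let fails : NodeFun b c (X × Tape) Prop := fun _ _ I s v =>
    ClusterFails I (A.radius I.N) (logN I.N + 1) (2 * logN I.N) (fun u => (s u).2) v
  have hfails : IsLocal (fun _ _ _ _ => True) ρ fails := by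
    refine IsLocal.mono (ρ := rB) ?_ fun N => Nat.le_add_left _ _
    intro V V' _ _ I I' s s' v v' _ _ hN hv
    simp only [fails]
    rw [clusterFails_congr (Network.view_comp hv _ (fun u => (s' u).2) fun u _ u' _ _ hs => by
      rw [hs]), hN]
  let clus : ∀ (V : Type) [Fintype V], Network b c V → (V → X × Tape) → V → ℕ × ℕ :=
    fun _ _ I s => cluster I (A.radius I.N) (2 * logN I.N) fun u => (s u).2
  -- Outputs need to be local only when no node fails anywhere; otherwise a flag is raised and the
  -- outputs do not matter.
  have hout : IsLocal (fun V _ I s => ∀ v, ¬ fails V I s v) ρ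
      fun V _ I s v => simOutput A y₀ V I (fun u => ((s u).1, clus V I s u)) v := by
    intro V V' _ _ I I' s s' v v' hQ hQ' hN hv
    refine isLocal_simOutput A y₀ (fun N => logN N + 1)
      (fun N => 2 * (A.radius N * (2 * logN N))) V V' I I' _ _ v v'
      (isDecomposition_cluster hQ) (isDecomposition_cluster hQ') hN ?_
    refine Network.view_comp (Network.view_extend hv (clus V I s) (clus V' I' s') ?_) _ _
      fun u _ u' _ _ hs => ?_
    · intro u u' hu
      simp only [clus]
      rw [← hN]
      exact cluster_congr (Network.view_comp hu _ _ fun w _ w' _ _ hs => by rw [hs])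
    · rw [Prod.mk.injEq] at hs
      rw [hs.1, hs.2]
  classical
  obtain ⟨step₁, h₁⟩ := hout.exists_step
  obtain ⟨step₂, h₂⟩ := hfails.exists_step
  refine ⟨⟨ρ, fun N w => (step₁ N w, decide (step₂ N w))⟩, ?_, fun V _ _ I x => ?_⟩
  · intro n N hn hnN hN
    have hr := hA n N hn hnN hN
    have hL : logN N ≤ logN (n ^ b) := Nat.succ_le_succ (Nat.log_mono_right hN)
    have h1 := simRadius_le A.radius N
    have h2 := clusterRadius_le A.radius N
    have h3 := Nat.mul_le_mul hr (Nat.pow_le_pow_left hL 2)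
    simp only [ρ, rB]
    omega
  · simp only [LocalAlg.output]
    simp only [decide_eq_false_iff_not, decide_eq_true_iff, h₂ _ _ _ _ trivial]
    refine ⟨fun R hR => ?_, fun v => measurableSet_clusterFails I _ _ _ v,
      sum_measureReal_clusterFails_lt_one I _⟩
    obtain ⟨y, hy, hspec⟩ := h V I x _ (isProcessingOrder_colorOrder I
      (clus V I fun u => (x u, R u)))
    convert hspec using 1
    funext v
    rw [h₁ V I (fun u => (x u, R u)) v hR]
    have := output_eq_simOutput A y₀ I (fun u => (x u, clus V I (fun u => (x u, R u)) u)) v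
    exact Option.some.inj (this.symm.trans (hy v))

/-- A clustering can be computed by a deterministic SLOCAL algorithm. -/
theorem seqSolves_isDecomposition (ρ : ℕ → ℕ) :
    SeqSolves (b := b) (c := c) (S := X) (fun N => 4 * (ρ N * (2 * logN N))) fun _ _ I _ z =>
      IsDecomposition I (ρ I.N) (logN I.N + 1) (2 * (ρ I.N * (2 * logN I.N))) z := by
  let rB : ℕ → ℕ := fun N => ρ N * (2 * logN N)
  have hfails : IsLocal (b := b) (c := c) (L := X × Tape) (fun _ _ _ _ => True) rB
      fun _ _ I s v =>
        ClusterFails I (ρ I.N) (logN I.N + 1) (2 * logN I.N) (fun u => (s u).2) v := by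
    intro V V' _ _ I I' s s' v v' _ _ hN hv
    beta_reduce
    rw [clusterFails_congr (Network.view_comp hv _ (fun u => (s' u).2) fun u _ u' _ _ hs => by
      rw [hs]), hN]
  have hclus : IsLocal (b := b) (c := c) (L := X × Tape) (fun _ _ _ _ => True) rB
      fun _ _ I s v => cluster I (ρ I.N) (2 * logN I.N) (fun u => (s u).2) v := by
    intro V V' _ _ I I' s s' v v' _ _ hN hv
    beta_reduce
    rw [cluster_congr (Network.view_comp hv _ (fun u => (s' u).2) fun u _ u' _ _ hs => by
      rw [hs]), hN]
  have h₁ := seqSolves_of_sum_lt_one (Q := fun _ _ _ _ => True) hfails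
    (fun V _ _ I x _ u => measurableSet_clusterFails I _ _ _ u)
    (fun V _ _ I x _ => sum_measure_lt_one_of_real (sum_measureReal_clusterFails_lt_one I _))
  have h₂ := (h₁.comp hclus.seqSolves).mono
    (T' := fun V _ I _ z =>
      IsDecomposition I (ρ I.N) (logN I.N + 1) (2 * (ρ I.N * (2 * logN I.N))) z) (by
    rintro V _ _ I x z ⟨R, hR, hz⟩
    rw [funext (hz trivial)]
    exact isDecomposition_cluster (hR trivial))
  convert h₂ using 2
  simp only [rB]
  ring

/-- Derandomization of a Monte Carlo SLOCAL algorithm of locality `A.radius N` by means of a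
local checker. -/
theorem seqSolves_of_monteCarlo {P : DistProblem X Y} {M : Type} (A : SLocalAlg (X × Tape) Y M)
    (D : LocalAlg (X × Y) Bool)
    (hD : ∀ (V : Type) [Fintype V] [Nonempty V] (I : Network b c V) (x : V → X) (y : V → Y),
      (∀ v, D.output I (fun u => (x u, y u)) v = true) ↔ P.spec I.graph x y)
    (hA : ∀ (V : Type) [Fintype V] [Nonempty V] (I : Network b c V) (x : V → X) (order : List V),
      IsProcessingOrder order →
        (∀ B : Set (V → Option Y),
          MeasurableSet {R : V → Tape | A.output I (fun v => (x v, R v)) order ∈ B}) ∧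
        1 - 1 / (Fintype.card V : ℝ) < (tapesMeasure V).real
          {R : V → Tape | P.SolvedBy I.graph x (A.output I (fun v => (x v, R v)) order)}) :
    SeqSolves (b := b) (c := c)
      (fun N => 4 * (A.radius N * (2 * logN N)) + 8 * simRadius A.radius N + 4 * D.radius N)
      fun _ _ I x y => P.spec I.graph x y := by
  obtain ⟨y₀, -⟩ := A.nonempty_output
  have : Nonempty Y := ⟨y₀⟩
  let Q : StateProp b c (X × (ℕ × ℕ)) := fun _ _ I s => IsDecomposition I (A.radius I.N)
    (logN I.N + 1) (2 * (A.radius I.N * (2 * logN I.N))) fun u => (s u).2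
  let out : NodeFun b c ((X × (ℕ × ℕ)) × Tape) Y := fun V _ I s v =>
    simOutput A y₀ V I (fun u => (((s u).1.1, (s u).2), (s u).1.2)) v
  let bad : NodeFun b c ((X × (ℕ × ℕ)) × Tape) Prop := fun V _ I s v =>
    ¬ D.output I (fun u => ((s u).1.1, out V I s u)) v = true
  have hout : IsLocal (fun V _ I s => Q V I fun v => (s v).1) (simRadius A.radius) out := by
    intro V V' _ _ I I' s s' v v' hQ hQ' hN hv
    exact isLocal_simOutput A y₀ (fun N => logN N + 1)
      (fun N => 2 * (A.radius N * (2 * logN N))) V V' I I' _ _ v v' hQ hQ' hN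
      (Network.view_comp hv _ _ fun u _ u' _ _ hs => by rw [hs])
  have hbad : IsLocal (fun V _ I s => Q V I fun v => (s v).1)
      (fun N => D.radius N + simRadius A.radius N) bad := by
    intro V V' _ _ I I' s s' v v' hQ hQ' hN hv
    simp only [bad]
    rw [D.output_congr (s' := fun u => ((s' u).1.1, out V' I' s' u)) hN ?_]
    refine Network.view_comp (Network.view_extend hv (out V I s) (out V' I' s') ?_) _ _
      fun u _ u' _ _ hs => ?_
    · exact fun u u' hu => hout V V' I I' s s' u u' hQ hQ' hN hu
    · rw [Prod.mk.injEq] at hs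
      rw [hs.1, hs.2]
  have houtput : ∀ (V : Type) [Fintype V] (I : Network b c V) (s : V → X × (ℕ × ℕ))
      (R : V → Tape), A.output I (fun v => ((s v).1, R v)) (colorOrder I fun u => (s u).2) =
        fun v => some (out V I (fun u => (s u, R u)) v) := fun V _ I s R =>
    funext (output_eq_simOutput A y₀ I fun u => (((s u).1, R u), (s u).2))
  have hmeas : ∀ (V : Type) [Fintype V] [Nonempty V] (I : Network b c V) (s : V → X × (ℕ × ℕ)),
      Q V I s → ∀ u, MeasurableSet {R : V → Tape | bad V I (fun w => (s w, R w)) u} := by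
    intro V _ _ I s _ u
    -- The clustering in `s` does not depend on the bits of `A`, so its color order is a fixed order
    -- to which the Monte Carlo guarantee applies.
    have h := (hA V I (fun v => (s v).1) _ (isProcessingOrder_colorOrder I fun u => (s u).2)).1
      {o | ¬ D.output I (fun w => ((s w).1, (o w).getD y₀)) u = true}
    simp only [houtput] at h
    exact h
  have hsum : ∀ (V : Type) [Fintype V] [Nonempty V] (I : Network b c V) (s : V → X × (ℕ × ℕ)),
      Q V I s → ∑ u, tapesMeasure V {R : V → Tape | bad V I (fun w => (s w, R w)) u} < 1 := by
    intro V _ _ I s hQ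
    apply sum_measure_lt_one_of_real
    obtain ⟨h1, h2⟩ := hA V I (fun v => (s v).1) _
      (isProcessingOrder_colorOrder I fun u => (s u).2)
    set G := {R : V → Tape | P.SolvedBy I.graph (fun v => (s v).1)
      (A.output I (fun v => ((s v).1, R v)) (colorOrder I fun u => (s u).2))}
    have hG : MeasurableSet G := h1 {o | P.SolvedBy I.graph (fun v => (s v).1) o}
    have hn : (0 : ℝ) < Fintype.card V := by exact_mod_cast Fintype.card_pos
    -- A rejection anywhere means that the whole output is wrong, an event of probability below `1 /
    -- n`; summing over `n` nodes stays below `1`.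
    have hle : ∀ u, (tapesMeasure V).real {R : V → Tape | bad V I (fun w => (s w, R w)) u} ≤
        (tapesMeasure V).real Gᶜ := by
      refine fun u => measureReal_mono fun R hR hRG => hR ?_
      obtain ⟨y, hy, hspec⟩ := hRG
      rw [houtput] at hy
      have hyo : (out V I fun u => (s u, R u)) = y := funext fun v => Option.some.inj (hy v)
      have := (hD V I (fun v => (s v).1) y).2 hspec u
      rwa [← hyo] at this
    refine (Finset.sum_le_sum fun u _ => hle u).trans_lt ?_
    rw [Finset.sum_const, nsmul_eq_mul, Finset.card_univ, probReal_compl_eq_one_sub hG]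
    have h3 : 1 - (tapesMeasure V).real G < 1 / (Fintype.card V : ℝ) := by linarith
    calc _ < (Fintype.card V : ℝ) * (1 / Fintype.card V) := mul_lt_mul_of_pos_left h3 hn
      _ = 1 := by field_simp
  have h₁ := (seqSolves_of_sum_lt_one hbad hmeas hsum).comp hout.seqSolves
  -- Three stages: clustering, good bit strings for the simulated algorithm, and evaluation of its
  -- outputs. The doubling in each composition yields the coefficients `4`, `8`, `4`.
  have h₂ := ((seqSolves_isDecomposition (b := b) (c := c) (X := X) A.radius).comp h₁).mono
    (T' := fun _ _ I x y => P.spec I.graph x y) (by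
    rintro V _ _ I x y ⟨z, hz, R, hR, hy⟩
    rw [← hD V I x y]
    intro v
    rw [funext (hy hz)]
    exact not_not.1 (hR hz v))
  convert h₂ using 2
  ring

theorem hopBall_of_subsingleton {V : Type} [Subsingleton V] (G : SimpleGraph V) (v : V) (r : ℕ) :
    hopBall G v r = Set.univ :=
  Set.eq_univ_of_forall fun u => Subsingleton.elim v u ▸ mem_hopBall_self v r

/-- On networks with one node, locality `0` suffices. -/
theorem SLocalAlg.exists_radius_zero {M : Type} (A : SLocalAlg X Y M) :
    ∃ A' : SLocalAlg X Y M, (A'.radius = fun N => if N ≤ 1 then 0 else A.radius N) ∧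
      ∀ (V : Type) [Fintype V] (I : Network b c V) (x : V → X) (order : List V),
        A'.output I x order = A.output I x order := by
  refine ⟨⟨fun N => if N ≤ 1 then 0 else A.radius N, A.step⟩, rfl, fun V _ I x order => ?_⟩
  have hview : ∀ (s : V → X × Option (Y × M)) v,
      I.view s (if I.N ≤ 1 then 0 else A.radius I.N) v = I.view s (A.radius I.N) v := by
    intro s v
    split_ifs with hN
    · have : Subsingleton V := Fintype.card_le_one_iff_subsingleton.1 (I.card_le.trans hN)
      simp only [Network.view, hopBall_of_subsingleton]
    · rfl
  unfold output run
  simp only [hview]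

end Classes

/-! ### Logarithmic bounds and the main theorem. -/

section Bounds

theorem logb_two_nonneg (n : ℕ) : 0 ≤ Real.logb 2 n := by
  rcases Nat.eq_zero_or_pos n with rfl | h
  · simp
  · exact Real.logb_nonneg one_lt_two (by exact_mod_cast h)

theorem one_le_logb_two {n : ℕ} (hn : 2 ≤ n) : 1 ≤ Real.logb 2 n := by
  rw [Real.le_logb_iff_rpow_le one_lt_two (by positivity)]
  simpa using (by exact_mod_cast hn : (2 : ℝ) ≤ n)

theorem logN_le_two_mul_logb {N : ℕ} (hN : 2 ≤ N) : (logN N : ℝ) ≤ 2 * Real.logb 2 N := by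
  have h1 : (Nat.log 2 N : ℝ) ≤ Real.logb 2 N := Real.natLog_le_logb N 2
  have h2 := one_le_logb_two hN
  unfold logN
  push_cast
  linarith

/-- The assumption `2 ≤ N` lets the logarithm absorb the additive `1` in `logN`. -/
theorem logN_le {b n N : ℕ} (hN : 2 ≤ N) (hNn : N ≤ n ^ b) :
    (logN N : ℝ) ≤ 2 * (b * Real.logb 2 n) := by
  refine (logN_le_two_mul_logb hN).trans ?_
  rw [← Real.logb_pow]
  have : Real.logb 2 (N : ℝ) ≤ Real.logb 2 ((n : ℝ) ^ b) :=
    Real.logb_le_logb_of_le one_lt_two (by positivity) (by exact_mod_cast hNn)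
  linarith

theorem IsPolylog.const_mul {t : ℕ → ℕ} (h : IsPolylog t) (a : ℕ) :
    IsPolylog fun n => a * t n := by
  obtain ⟨k, hk⟩ := h
  refine ⟨k, ?_⟩
  simpa using hk.const_mul_left (a : ℝ)

theorem IsPolylog.mul_logN_sq {t : ℕ → ℕ} (h : IsPolylog t) {b : ℕ} (hb : 1 ≤ b) :
    IsPolylog fun n => t n * logN (n ^ b) ^ 2 := by
  obtain ⟨k, hk⟩ := h
  refine ⟨k + 2, ?_⟩
  have hL : (fun n : ℕ => (logN (n ^ b) : ℝ)) =O[Filter.atTop] fun n : ℕ => Real.logb 2 n := by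
    refine Asymptotics.IsBigO.of_bound (2 * b) ?_
    filter_upwards [Filter.eventually_ge_atTop 2] with n hn
    rw [Real.norm_of_nonneg (Nat.cast_nonneg _), Real.norm_of_nonneg (logb_two_nonneg n), mul_assoc]
    exact logN_le (hn.trans (Nat.le_self_pow (by omega) n)) le_rfl
  simpa [pow_add] using hk.mul (hL.pow 2)

end Bounds

theorem PolyZLOCAL_eq_PolySLOCAL {b : ℕ} (c : ℕ) (hb : 1 ≤ b) (X Y : Type) :
    (PolyZLOCAL b c : Set (DistProblem X Y)) = PolySLOCAL b c := by
  ext P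
  constructor
  · rintro ⟨t, ht, hP⟩
    exact ⟨_, ht.const_mul 4, ZLOCAL_subset_SLOCAL t hP⟩
  · rintro ⟨t, ht, hP⟩
    exact ⟨_, (ht.mul_logN_sq hb).const_mul 12, SLOCAL_subset_ZLOCAL t hP⟩

/-- The simulation gives `8 * 10` and the clustering `4 * 2`, together `88`; squaring `logN N ≤ 2 *
b * log₂ n` contributes `4 * b ^ 2`, whence `352 * b ^ 2`. The `4` comes from the checker radius. -/
theorem exists_SLOCAL_of_locallyCheckable {b c : ℕ} {X Y : Type} {P : DistProblem X Y} {d : ℕ}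
    {r : ℕ → ℕ} (hD : LocallyCheckable b c d P) (hP : P ∈ RandSLOCAL b c r) :
    P ∈ SLOCAL b c fun n =>
      ⌊(352 * (b : ℝ) ^ 2 + 4) * ((r n : ℝ) * Real.logb 2 n ^ 2 + d)⌋₊ := by
  obtain ⟨D, hDd, hD⟩ := hD
  obtain ⟨M, A, hA, h⟩ := hP
  obtain ⟨A', hrad, hout⟩ := A.exists_radius_zero (b := b) (c := c)
  refine (seqSolves_of_monteCarlo A' D hD ?_).mem_SLOCAL ?_
  · intro V _ _ I x order ho
    simp only [hout]
    exact h V I x order ho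
  · intro n N hn hnN hN
    refine Nat.le_floor ?_
    have h1 := simRadius_le A'.radius N
    have h2 := clusterRadius_le A'.radius N
    have h3 := hDd N
    have hle : 4 * (A'.radius N * (2 * logN N)) + 8 * simRadius A'.radius N + 4 * D.radius N ≤
        88 * (A'.radius N * logN N ^ 2) + 4 * d := by omega
    have hR : (A'.radius N : ℝ) * (logN N : ℝ) ^ 2 ≤
        4 * (b : ℝ) ^ 2 * (r n * Real.logb 2 n ^ 2) := by
      -- For `n = 1` the logarithm vanishes, so the bound leaves no room for `r`; this is why `A`
      -- was replaced by `A'`, of radius `0` when `N ≤ 1`.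
      rcases Nat.lt_or_ge N 2 with hN2 | hN2
      · have : A'.radius N = 0 := by rw [hrad]; exact if_pos (by omega)
        rw [this]
        simp only [Nat.cast_zero, zero_mul]
        positivity
      · have hr : A'.radius N ≤ r n := by
          rw [hrad]
          simp only [if_neg (show ¬ N ≤ 1 by omega)]
          exact hA n N hn hnN hN
        calc (A'.radius N : ℝ) * (logN N : ℝ) ^ 2
            ≤ r n * (2 * (b * Real.logb 2 n)) ^ 2 := by
              gcongr
              exact logN_le hN2 hN
          _ = _ := by ring
    calc _ ≤ ((88 * (A'.radius N * logN N ^ 2) + 4 * d : ℕ) : ℝ) := by exact_mod_cast hle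
      _ = 88 * ((A'.radius N : ℝ) * (logN N : ℝ) ^ 2) + 4 * d := by push_cast; ring
      _ ≤ 88 * (4 * (b : ℝ) ^ 2 * (r n * Real.logb 2 n ^ 2)) + 4 * d := by gcongr
      _ ≤ _ := by
        have h4 : (0 : ℝ) ≤ r n * Real.logb 2 n ^ 2 := by positivity
        have h5 : (0 : ℝ) ≤ (b : ℝ) ^ 2 * d := by positivity
        nlinarith

theorem mainTheorem6 (b c : ℕ) (hb : 1 ≤ b) (hc : 1 ≤ c) :
    (∃ C : ℝ, ∀ (X Y : Type) (P : DistProblem X Y) (d : ℕ) (r : ℕ → ℕ),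
      LocallyCheckable b c d P → P ∈ RandSLOCAL b c r →
        ∃ t : ℕ → ℕ, P ∈ SLOCAL b c t ∧
          (∀ n : ℕ, 1 ≤ n → (t n : ℝ) ≤ C * ((r n : ℝ) * Real.logb 2 n ^ 2 + d)) ∧
          ((∀ᶠ n in Filter.atTop, 1 ≤ r n) →
            (fun n => (t n : ℝ)) =O[Filter.atTop]
              fun n : ℕ => (r n : ℝ) * Real.logb 2 n ^ 2)) ∧
    (∀ X Y : Type,
      (PolyZLOCAL b c : Set (DistProblem X Y)) = (PolySLOCAL b c : Set (DistProblem X Y))) := by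
  refine ⟨⟨352 * (b : ℝ) ^ 2 + 4, fun X Y P d r hD hP => ?_⟩, PolyZLOCAL_eq_PolySLOCAL c hb⟩
  have hle : ∀ n : ℕ,
      (⌊(352 * (b : ℝ) ^ 2 + 4) * ((r n : ℝ) * Real.logb 2 n ^ 2 + d)⌋₊ : ℝ) ≤
        (352 * (b : ℝ) ^ 2 + 4) * ((r n : ℝ) * Real.logb 2 n ^ 2 + d) := fun n =>
    Nat.floor_le (by positivity)
  refine ⟨_, exists_SLOCAL_of_locallyCheckable hD hP, fun n _ => hle n, fun hr => ?_⟩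
  -- Once `r n * log₂ n ^ 2` is at least `1`, the additive `d` is absorbed by the factor `1 + d`.
  refine Asymptotics.IsBigO.of_bound ((352 * (b : ℝ) ^ 2 + 4) * (1 + d)) ?_
  filter_upwards [hr, Filter.eventually_ge_atTop 2] with n hrn hn
  rw [Real.norm_of_nonneg (Nat.cast_nonneg _), Real.norm_of_nonneg (by positivity), mul_assoc]
  refine (hle n).trans (mul_le_mul_of_nonneg_left ?_ (by positivity))
  have h1 : (1 : ℝ) ≤ r n := by exact_mod_cast hrn
  have h2 : 1 ≤ (r n : ℝ) * Real.logb 2 n ^ 2 :=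
    one_le_mul_of_one_le_of_one_le h1 (one_le_pow₀ (one_le_logb_two hn))
  nlinarith [mul_le_mul_of_nonneg_left h2 (Nat.cast_nonneg (α := ℝ) d)]
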